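/- Theorem 2.3. Let $\varepsilon_0>0$, $\varepsilon>0$, $\tau>0$, $\lambda\in\mathbb R\setminus\{0\}$ and $\beta\in\mathbb R$, and put $$\eta=\Big(\frac{(\varepsilon-\varepsilon_0)\tau}{2\pi}\Big)^2,\qquad \xi=\Big(\frac{\lambda\tau}{\pi}\Big)^2,\qquad p_{\rm at}(-)=\frac1{1+e^{-\beta\varepsilon}},\qquad p_{\rm at}(+)=\frac{e^{-\beta\varepsilon}}{1+e^{-\beta\varepsilon}} .$$ Let $\mathcal H$ be the bosonic Fock space over $\mathbb C$, that is $\ell^2(\mathbb N)$ with orthonormal basis $(|n\rangle)_{n\ge 0}$, number operator $N|n\rangle=n|n\rangle$, and $a|n\rangle=\sqrt n\,|n-1\rangle$, $a^*|n\rangle=\sqrt{n+1}\,|n+1\rangle$. With $$C(x)=\cos\big(\pi\sqrt{\xi x+\eta}\big)+i\,\eta^{1/2}\,\frac{\sin\big(\pi\sqrt{\xi x+\eta}\big)}{\sqrt{\xi x+\eta}},\qquad S(x)=\xi^{1/2}\,\frac{\sin\big(\pi\sqrt{\xi x+\eta}\big)}{\sqrt{\xi x+\eta}}$$ (with second term of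 $C(0)$ equal to $0$ if $\eta=0$), the one-atom maser is described by the bounded operators on $\mathcal H$ $$V_{--}=p_{\rm at}(-)^{1/2}e^{-i\tau\varepsilon N}C(N),\qquad V_{-+}=p_{\rm at}(-)^{1/2}e^{-i\tau\varepsilon N}S(N+1)\,a,$$ $$V_{+-}=p_{\rm at}(+)^{1/2}e^{-i\tau\varepsilon N}S(N)\,a^*,\qquad V_{++}=p_{\rm at}(+)^{1/2}e^{-i\tau\varepsilon N}C(N+1)^*,$$ which satisfy $\sum_{\sigma,\sigma'=\pm}V_{\sigma\sigma'}^*V_{\sigma\sigma'}=1$. Let $\Omega=(\{-,+\}^2)^{\mathbb N^*}$ with the $\sigma$-algebra generated by the cylinder sets, and let $\theta:\Omega\to\Omega$, $\theta(\omega)_t=\omega_{t+1}$, be the left shift. A state is a positive semidefinite trace class operator on $\mathcal H$ with trace $1$. For a state $\rho$, let $\mathbb P^\rho$ be the probability measure on $\Omega$ (the law of the sequence of measurement outcomes) with $$\mathbb P^\rho\big(\{z\in\Omega: z_1=\omega_1,\dots,z_t=\omega_t\}\big)={\rm Tr}\big(W_t(\omega)\,\rho\, W_t(\omega)^*\big),\qquad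 W_t(\omega)=V_{\omega_t}\cdots V_{\omega_1},$$ for all $t\ge 1$ and all $\omega\in\Omega$. Assume that $\beta>0$ and that the system is non-resonant: there are no positive integers $n,k$ with $\xi n+\eta=k^2$. Let $\rho_{\rm inv}=e^{-\beta\varepsilon N}/{\rm Tr}(e^{-\beta\varepsilon N})$. Then for every state $\rho$, $$\lim_{t\to\infty}\big\|\mathbb P^\rho\circ\theta^{-t}-\mathbb P^{\rho_{\rm inv}}\big\|_{TV}=0,$$ where $\|\cdot\|_{TV}$ is the total variation norm of finite signed measures on $\Omega$. -/

import Mathlib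

namespace OneAtomMaser

open MeasureTheory ProbabilityTheory
open scoped ENNReal InnerProductSpace

noncomputable section

/-! ### Model parameters -/

/-- Parameters of the one-atom maser: cavity frequency `ε₀ > 0`, Bohr frequency `ε > 0` of the atoms,
coupling `lam ≠ 0` (half of the Rabi frequency), interaction time `τ > 0` and inverse temperature
`β` of the atoms (any real number). -/
structure MaserParams where
  ε₀ : ℝ
  ε : ℝ
  lam : ℝ
  τ : ℝ
  β : ℝ
  ε₀_pos : 0 < ε₀
  ε_pos : 0 < ε
  lam_ne_zero : lam ≠ 0
  τ_pos : 0 < τ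

namespace MaserParams

variable (p : MaserParams)

/-- The detuning `Δ = ε - ε₀`. -/
def Δ : ℝ := p.ε - p.ε₀

/-- The dimensionless detuning parameter. -/
def η : ℝ := (p.Δ * p.τ / (2 * Real.pi)) ^ 2

/-- The dimensionless coupling constant. -/
def ξ : ℝ := (p.lam * p.τ / Real.pi) ^ 2

/-- The positive integer `n` is a Rabi resonance if `ξ n + η` is the square of a positive integer. -/
def IsRabiResonance (n : ℕ) : Prop :=
  0 < n ∧ ∃ k : ℕ, 0 < k ∧ p.ξ * n + p.η = (k : ℝ) ^ 2

/-- The non-resonance condition: there is no Rabi resonance. -/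
def NonResonant : Prop := ∀ n : ℕ, ¬ p.IsRabiResonance n

/-- Probability that an atom enters the cavity in its ground state `-` (encoded as `false`) or in its
excited state `+` (encoded as `true`). -/
def pAt : Bool → ℝ
  | false => 1 / (1 + Real.exp (-p.β * p.ε))
  | true => Real.exp (-p.β * p.ε) / (1 + Real.exp (-p.β * p.ε))

/-- `C(x) = cos (π √(ξ x + η)) + i η^{1/2} sin (π √(ξ x + η)) / √(ξ x + η)`.
If `ξ x + η = 0` then `η = x = 0` and the second term vanishes. -/
def C (x : ℝ) : ℂ :=
  (Real.cos (Real.pi * √(p.ξ * x + p.η)) : ℂ) +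
    Complex.I * ((√p.η * (Real.sin (Real.pi * √(p.ξ * x + p.η)) / √(p.ξ * x + p.η)) : ℝ) : ℂ)

/-- `S(x) = ξ^{1/2} sin (π √(ξ x + η)) / √(ξ x + η)`. The value `S(0)` never plays a role, because
`S(N)` is only applied to the range of the creation operator (see `krausSeq`). -/
def S (x : ℝ) : ℝ :=
  √p.ξ * (Real.sin (Real.pi * √(p.ξ * x + p.η)) / √(p.ξ * x + p.η))

end MaserParams

/-! ### The Hilbert space of the cavity and its operators -/

/-- The bosonic Fock space over `ℂ`, i.e. `ℓ²(ℕ)`; the coordinate `n` is the amplitude of the Fock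
state with `n` photons. -/
abbrev Fock : Type := lp (fun _ : ℕ => ℂ) 2

/-- The Fock basis vector `|n⟩`. -/
def fock (n : ℕ) : Fock := lp.single 2 n (1 : ℂ)

/-- The function `f(N)` of the number operator, on arbitrary sequences of amplitudes. -/
def funN (f : ℕ → ℂ) : (ℕ → ℂ) →ₗ[ℂ] (ℕ → ℂ) where
  toFun ψ n := f n * ψ n
  map_add' ψ φ := by ext n; simp [mul_add]
  map_smul' c ψ := by ext n; simp; ring

/-- The annihilation operator, `a|n⟩ = √n |n-1⟩`, on arbitrary sequences of amplitudes. -/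
def annihilation : (ℕ → ℂ) →ₗ[ℂ] (ℕ → ℂ) where
  toFun ψ n := (√((n : ℝ) + 1) : ℂ) * ψ (n + 1)
  map_add' ψ φ := by ext n; simp [mul_add]
  map_smul' c ψ := by ext n; simp; ring

/-- The creation operator, `a*|n⟩ = √(n+1) |n+1⟩`, on arbitrary sequences of amplitudes (the
amplitude of `|0⟩` in the image is `√0 * _ = 0`). -/
def creation : (ℕ → ℂ) →ₗ[ℂ] (ℕ → ℂ) where
  toFun ψ n := (√(n : ℝ) : ℂ) * ψ (n - 1)
  map_add' ψ φ := by ext n; simp [mul_add]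
  map_smul' c ψ := by ext n; simp; ring

/-- A linear map on sequences that does not increase the `ℓ²` norm restricts to a bounded operator
on the Fock space. -/
def ofSeqMap (T : (ℕ → ℂ) →ₗ[ℂ] (ℕ → ℂ))
    (hT : ∀ (ψ : Fock) (s : Finset ℕ), ∑ n ∈ s, ‖T (⇑ψ) n‖ ^ 2 ≤ ‖ψ‖ ^ 2) : Fock →L[ℂ] Fock :=
  LinearMap.mkContinuous
    { toFun := fun ψ => ⟨T (⇑ψ), memℓp_gen' (C := ‖ψ‖ ^ 2) (fun s => by simpa using hT ψ s)⟩
      map_add' := fun ψ φ => Subtype.ext (map_add T (⇑ψ) (⇑φ))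
      map_smul' := fun c ψ => Subtype.ext (map_smul T c (⇑ψ)) }
    1 (fun ψ => by
      rw [one_mul]
      refine lp.norm_le_of_forall_sum_le (by norm_num) (norm_nonneg _) (fun s => ?_)
      simpa using hT ψ s)

@[simp] theorem ofSeqMap_apply (T : (ℕ → ℂ) →ₗ[ℂ] (ℕ → ℂ))
    (hT : ∀ (ψ : Fock) (s : Finset ℕ), ∑ n ∈ s, ‖T (⇑ψ) n‖ ^ 2 ≤ ‖ψ‖ ^ 2) (ψ : Fock) (n : ℕ) :
    ofSeqMap T hT ψ n = T (⇑ψ) n := rfl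

/-- A weighted composition operator is a contraction. -/
theorem sum_norm_sq_le (c : ℕ → ℂ) (g : ℕ → ℕ) (hc : ∀ n, ‖c n‖ ≤ 1)
    (hg : ∀ m n, c m ≠ 0 → c n ≠ 0 → g m = g n → m = n) (ψ : Fock) (s : Finset ℕ) :
    ∑ n ∈ s, ‖c n * ψ (g n)‖ ^ 2 ≤ ‖ψ‖ ^ 2 := by
  classical
  have h1 : ∑ n ∈ s, ‖c n * ψ (g n)‖ ^ 2
      ≤ ∑ n ∈ s.filter (fun n => c n ≠ 0), ‖ψ (g n)‖ ^ 2 := by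
    rw [Finset.sum_filter]
    refine Finset.sum_le_sum (fun n _ => ?_)
    split_ifs with h
    · rw [norm_mul, mul_pow]
      have : ‖c n‖ ^ 2 ≤ 1 := pow_le_one₀ (norm_nonneg _) (hc n)
      nlinarith [sq_nonneg ‖ψ (g n)‖]
    · rw [not_not.mp h]; simp
  have h2 : ∑ n ∈ s.filter (fun n => c n ≠ 0), ‖ψ (g n)‖ ^ 2
      = ∑ m ∈ (s.filter (fun n => c n ≠ 0)).image g, ‖ψ m‖ ^ 2 := by
    rw [Finset.sum_image]
    intro m hm n hn h
    simp only [Finset.coe_filter, Set.mem_ofPred_eq] at hm hn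
    exact hg m n hm.2 hn.2 h
  have h3 := lp.sum_rpow_le_norm_rpow (p := 2) (by norm_num) ψ
    ((s.filter (fun n => c n ≠ 0)).image g)
  simp only [ENNReal.toReal_ofNat, Real.rpow_ofNat] at h3
  linarith

/-! ### Measurement outcomes and Kraus operators -/

/-- The result `(σ, σ')` of a two-time measurement of an atom, before and after its interaction with
the cavity; `false` stands for `-` and `true` for `+`. -/
abbrev Outcome : Type := Bool × Bool

namespace MaserParams

variable (p : MaserParams)

/-- The Kraus operators `V_{σσ'}`, on sequences of amplitudes:
`V_{--} = p_at(-)^{1/2} e^{-iτεN} C(N)`, `V_{-+} = p_at(-)^{1/2} e^{-iτεN} S(N+1) a`,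
`V_{+-} = p_at(+)^{1/2} e^{-iτεN} S(N) a*`, `V_{++} = p_at(+)^{1/2} e^{-iτεN} C(N+1)*`. -/
def krausSeq : Outcome → (ℕ → ℂ) →ₗ[ℂ] (ℕ → ℂ)
  | (false, false) => (√(p.pAt false) : ℂ) •
      (funN (fun n => Complex.exp (-Complex.I * p.τ * p.ε * n)) ∘ₗ funN (fun n => p.C n))
  | (false, true) => (√(p.pAt false) : ℂ) •
      (funN (fun n => Complex.exp (-Complex.I * p.τ * p.ε * n)) ∘ₗ
        funN (fun n => (p.S ((n : ℝ) + 1) : ℂ)) ∘ₗ annihilation)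
  | (true, false) => (√(p.pAt true) : ℂ) •
      (funN (fun n => Complex.exp (-Complex.I * p.τ * p.ε * n)) ∘ₗ
        funN (fun n => (p.S (n : ℝ) : ℂ)) ∘ₗ creation)
  | (true, true) => (√(p.pAt true) : ℂ) •
      (funN (fun n => Complex.exp (-Complex.I * p.τ * p.ε * n)) ∘ₗ
        funN (fun n => starRingEnd ℂ (p.C ((n : ℝ) + 1))))

/-- `(V_y ψ)(n) = krausCoef y n * ψ (krausSource y n)`. -/
def krausCoef : Outcome → ℕ → ℂ
  | (false, false), n => √(p.pAt false) * (Complex.exp (-Complex.I * p.τ * p.ε * n) * p.C n)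
  | (false, true), n => √(p.pAt false) * (Complex.exp (-Complex.I * p.τ * p.ε * n) *
      (p.S ((n : ℝ) + 1) * √((n : ℝ) + 1)))
  | (true, false), n => √(p.pAt true) * (Complex.exp (-Complex.I * p.τ * p.ε * n) *
      (p.S (n : ℝ) * √(n : ℝ)))
  | (true, true), n => √(p.pAt true) * (Complex.exp (-Complex.I * p.τ * p.ε * n) *
      starRingEnd ℂ (p.C ((n : ℝ) + 1)))

/-- The index of the amplitude which `V_y` moves to position `n`. -/
def krausSource : Outcome → ℕ → ℕ
  | (false, false), n => n
  | (false, true), n => n + 1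
  | (true, false), n => n - 1
  | (true, true), n => n

theorem krausSeq_apply (y : Outcome) (ψ : ℕ → ℂ) (n : ℕ) :
    p.krausSeq y ψ n = p.krausCoef y n * ψ (krausSource y n) := by
  rcases y with ⟨_ | _, _ | _⟩ <;>
    simp [krausSeq, krausCoef, krausSource, funN, annihilation, creation] <;> ring

theorem pAt_nonneg (σ : Bool) : 0 ≤ p.pAt σ := by
  cases σ <;> simp only [pAt] <;> positivity

theorem pAt_add : p.pAt false + p.pAt true = 1 := by
  simp only [pAt]; field_simp

theorem pAt_le_one (σ : Bool) : p.pAt σ ≤ 1 := by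
  have h := p.pAt_add
  have h0 := p.pAt_nonneg false
  have h1 := p.pAt_nonneg true
  cases σ <;> linarith

theorem ξ_pos : 0 < p.ξ := by
  have := p.lam_ne_zero
  have := p.τ_pos
  unfold ξ
  positivity

theorem η_nonneg : 0 ≤ p.η := by unfold η; positivity

/-- `|C(x)|² + x S(x)² = 1`. -/
theorem normSq_C_add (x : ℝ) (hx : 0 ≤ x) : ‖p.C x‖ ^ 2 + p.S x ^ 2 * x = 1 := by
  have hξ := p.ξ_pos
  have hη := p.η_nonneg
  have hq : 0 ≤ p.ξ * x + p.η := by positivity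
  rw [← Complex.normSq_eq_norm_sq, Complex.normSq_apply]
  simp only [C, S, Complex.add_re, Complex.add_im, Complex.ofReal_re, Complex.ofReal_im,
    Complex.mul_re, Complex.mul_im, Complex.I_re, Complex.I_im, zero_mul, one_mul, mul_zero,
    sub_zero, add_zero, zero_add]
  have hcs := Real.sin_sq_add_cos_sq (Real.pi * √(p.ξ * x + p.η))
  rcases hq.eq_or_lt with h0 | h0
  · have hx0 : p.ξ * x = 0 := by nlinarith [mul_nonneg hξ.le hx]
    have hη0 : p.η = 0 := by linarith
    have hx1 : x = 0 := by rcases mul_eq_zero.mp hx0 with h | h <;> linarith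
    simp [hη0, hx1]
  · set q := p.ξ * x + p.η with hqdef
    set s := Real.sin (Real.pi * √q)
    set c := Real.cos (Real.pi * √q)
    have e1 : (√p.η * (s / √q)) * (√p.η * (s / √q)) = p.η * (s ^ 2 / q) := by
      have a1 := Real.mul_self_sqrt hη
      have a2 := Real.sq_sqrt hq
      calc _ = (√p.η * √p.η) * (s ^ 2 / (√q) ^ 2) := by ring
        _ = _ := by rw [a1, a2]
    have e2 : (√p.ξ * (s / √q)) ^ 2 = p.ξ * (s ^ 2 / q) := by
      have a1 := Real.sq_sqrt hξ.le
      have a2 := Real.sq_sqrt hq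
      calc _ = (√p.ξ) ^ 2 * (s ^ 2 / (√q) ^ 2) := by ring
        _ = _ := by rw [a1, a2]
    have e3 : s ^ 2 / q * q = s ^ 2 := by field_simp
    have e4 : (c + 0) * (c + 0) = c ^ 2 := by ring
    rw [e1, e2]
    have : p.η * (s ^ 2 / q) + p.ξ * (s ^ 2 / q) * x = s ^ 2 := by
      calc _ = s ^ 2 / q * q := by rw [hqdef]; ring
        _ = _ := e3
    nlinarith

theorem normSq_phase (n : ℕ) : ‖Complex.exp (-Complex.I * p.τ * p.ε * n)‖ = 1 := by
  have : -Complex.I * p.τ * p.ε * n = ((-(p.τ * p.ε * n) : ℝ) : ℂ) * Complex.I := by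
    push_cast; ring
  rw [this, Complex.norm_exp_ofReal_mul_I]

/-- The probability `α_n = n S(n)²` of a transition of the atom in presence of `n` photons. -/
def α (n : ℕ) : ℝ := p.S n ^ 2 * n

theorem normSq_krausCoef (y : Outcome) (n : ℕ) : ‖p.krausCoef y n‖ ^ 2 =
    match y with
    | (false, false) => p.pAt false * (1 - p.α n)
    | (false, true) => p.pAt false * p.α (n + 1)
    | (true, false) => p.pAt true * p.α n
    | (true, true) => p.pAt true * (1 - p.α (n + 1)) := by
  have hs : ∀ σ, ‖((√(p.pAt σ) : ℝ) : ℂ)‖ ^ 2 = p.pAt σ := fun σ => by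
    rw [Complex.norm_real, Real.norm_eq_abs, sq_abs, Real.sq_sqrt (p.pAt_nonneg σ)]
  have hS : ∀ x : ℝ, 0 ≤ x → ‖((p.S x : ℝ) : ℂ)‖ ^ 2 * ‖((√x : ℝ) : ℂ)‖ ^ 2 = p.S x ^ 2 * x :=
    fun x hx => by
      rw [Complex.norm_real, Real.norm_eq_abs, sq_abs, Complex.norm_real, Real.norm_eq_abs, sq_abs,
        Real.sq_sqrt hx]
  have h1 := p.normSq_C_add n (by positivity)
  have h2 := p.normSq_C_add ((n : ℝ) + 1) (by positivity)
  rcases y with ⟨_ | _, _ | _⟩ <;> simp only [krausCoef, norm_mul, mul_pow, normSq_phase, hs, α,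
    one_mul, RCLike.norm_conj, Nat.cast_add, Nat.cast_one]
  · rw [← eq_sub_of_add_eq h1]
  · rw [hS _ (by positivity)]
  · rw [hS _ (by positivity)]
  · rw [← eq_sub_of_add_eq h2]

theorem α_nonneg (n : ℕ) : 0 ≤ p.α n := by unfold α; positivity

theorem α_le_one (n : ℕ) : p.α n ≤ 1 := by
  have h1 := p.normSq_C_add n (by positivity)
  unfold α
  nlinarith [sq_nonneg ‖p.C n‖]

theorem norm_krausCoef_le (y : Outcome) (n : ℕ) : ‖p.krausCoef y n‖ ≤ 1 := by
  have h := p.normSq_krausCoef y n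
  have ha := p.α_nonneg n
  have hb := p.α_nonneg (n + 1)
  have hc := p.α_le_one n
  have hd := p.α_le_one (n + 1)
  have h0 := p.pAt_nonneg false
  have h1 := p.pAt_nonneg true
  have h2 := p.pAt_le_one false
  have h3 := p.pAt_le_one true
  have : ‖p.krausCoef y n‖ ^ 2 ≤ 1 := by
    rw [h]
    rcases y with ⟨_ | _, _ | _⟩ <;> simp only <;> nlinarith
  nlinarith [norm_nonneg (p.krausCoef y n)]

theorem krausSeq_contraction (y : Outcome) (ψ : Fock) (s : Finset ℕ) :
    ∑ n ∈ s, ‖p.krausSeq y (⇑ψ) n‖ ^ 2 ≤ ‖ψ‖ ^ 2 := by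
  simp_rw [krausSeq_apply]
  refine sum_norm_sq_le _ _ (p.norm_krausCoef_le y) ?_ ψ s
  intro m n hm hn h
  rcases y with ⟨_ | _, _ | _⟩ <;> simp only [krausSource] at h
  · exact h
  · omega
  · have hpos : ∀ k, p.krausCoef (true, false) k ≠ 0 → k ≠ 0 := by
      rintro k hk rfl
      exact hk (by simp [krausCoef])
    have := hpos m hm
    have := hpos n hn
    omega
  · exact h

/-- The Kraus operators `V_{σσ'}` as bounded operators on the Fock space. -/
def kraus (y : Outcome) : Fock →L[ℂ] Fock := ofSeqMap (p.krausSeq y) (p.krausSeq_contraction y)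

/-- `W_t(ω) = V_{ω_t} ⋯ V_{ω_1}`. Sequences of outcomes are indexed from `0`, so that `ω j` is the
outcome of the `(j+1)`-st measurement. -/
def W (ω : ℕ → Outcome) : ℕ → (Fock →L[ℂ] Fock)
  | 0 => ContinuousLinearMap.id ℂ Fock
  | t + 1 => (p.kraus (ω t)).comp (W ω t)

end MaserParams

/-! ### States -/

/-- The trace `∑ ⟨n|A|n⟩` of a (trace class) operator. -/
def trace (A : Fock →L[ℂ] Fock) : ℂ := ∑' n : ℕ, ⟪fock n, A (fock n)⟫_ℂ

/-- The density operators: positive semidefinite operators which are trace class with unit trace.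
(A positive operator is trace class iff the sum of its diagonal elements in an orthonormal basis
converges.) -/
structure DensityOperator where
  op : Fock →L[ℂ] Fock
  isPositive : op.IsPositive
  hasSum_trace : HasSum (fun n : ℕ => ⟪fock n, op (fock n)⟫_ℂ) 1

theorem inner_fock (n : ℕ) (ψ : Fock) : ⟪fock n, ψ⟫_ℂ = ψ n := by
  simp [fock, lp.inner_single_left]

theorem fock_apply (n m : ℕ) : fock n m = if m = n then 1 else 0 := by
  simp [fock, lp.single_apply, Pi.single_apply]

namespace MaserParams

variable (p : MaserParams)

/-! ### The law of the measurement outcomes -/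

theorem kraus_apply (y : Outcome) (ψ : Fock) (n : ℕ) :
    p.kraus y ψ n = p.krausCoef y n * ψ (krausSource y n) := p.krausSeq_apply y ψ n

theorem adjoint_kraus_fock (y : Outcome) (n : ℕ) :
    (p.kraus y).adjoint (fock n) = starRingEnd ℂ (p.krausCoef y n) • fock (krausSource y n) := by
  refine ext_inner_right ℂ (fun ψ => ?_)
  rw [ContinuousLinearMap.adjoint_inner_left, inner_fock, kraus_apply, inner_smul_left, inner_fock]
  simp

/-- Diagonal elements of `V_y A V_y*`. -/
theorem inner_kraus_conj (y : Outcome) (A : Fock →L[ℂ] Fock) (n : ℕ) :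
    ⟪fock n, ((p.kraus y).comp (A.comp (p.kraus y).adjoint)) (fock n)⟫_ℂ =
      ((‖p.krausCoef y n‖ ^ 2 : ℝ) : ℂ) *
        ⟪fock (krausSource y n), A (fock (krausSource y n))⟫_ℂ := by
  rw [ContinuousLinearMap.comp_apply, ← ContinuousLinearMap.adjoint_inner_left,
    ContinuousLinearMap.comp_apply, adjoint_kraus_fock, map_smul, inner_smul_left, inner_smul_right,
    Complex.conj_conj, ← mul_assoc, Complex.mul_conj, Complex.normSq_eq_norm_sq]

/-- Trace preservation: one measurement step does not change the total weight. -/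
theorem kraus_trace (A : Fock →L[ℂ] Fock)
    (hA : Summable (fun n : ℕ => ⟪fock n, A (fock n)⟫_ℂ)) :
    (∀ y, Summable (fun n : ℕ =>
      ⟪fock n, ((p.kraus y).comp (A.comp (p.kraus y).adjoint)) (fock n)⟫_ℂ)) ∧
    ∑ y, trace ((p.kraus y).comp (A.comp (p.kraus y).adjoint)) = trace A := by
  set d : ℕ → ℂ := fun n => ⟪fock n, A (fock n)⟫_ℂ with hd
  have hs : ∀ f : ℕ → ℝ, (∀ n, 0 ≤ f n) → (∀ n, f n ≤ 1) → Summable (fun n => (f n : ℂ) * d n) := by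
    intro f h0 h1
    refine Summable.of_norm_bounded hA.norm (fun n => ?_)
    rw [norm_mul, Complex.norm_real, Real.norm_of_nonneg (h0 n)]
    exact mul_le_of_le_one_left (norm_nonneg _) (h1 n)
  have hX := hs p.α p.α_nonneg p.α_le_one
  have hY := hs (fun n => p.α (n + 1)) (fun n => p.α_nonneg _) (fun n => p.α_le_one _)
  set X := ∑' n, (p.α n : ℂ) * d n with hXdef
  set Y := ∑' n, (p.α (n + 1) : ℂ) * d n with hYdef
  have hα0 : p.α 0 = 0 := by simp [α]
  have hmm : HasSum (fun n : ℕ =>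
      ⟪fock n, ((p.kraus (false, false)).comp (A.comp (p.kraus (false, false)).adjoint))
        (fock n)⟫_ℂ) (p.pAt false * (trace A - X)) := by
    simp_rw [inner_kraus_conj, normSq_krausCoef, krausSource]
    refine Eq.mp (congrArg (fun f => HasSum f _) (funext fun n => ?_))
      ((hA.hasSum.sub hX.hasSum).mul_left (p.pAt false : ℂ))
    simp only [hd]
    push_cast; ring
  have hmp : HasSum (fun n : ℕ =>
      ⟪fock n, ((p.kraus (false, true)).comp (A.comp (p.kraus (false, true)).adjoint))
        (fock n)⟫_ℂ) (p.pAt false * X) := by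
    simp_rw [inner_kraus_conj, normSq_krausCoef, krausSource]
    have h := (hasSum_nat_add_iff' 1).mpr hX.hasSum
    simp only [Finset.range_one, Finset.sum_singleton, hα0, Complex.ofReal_zero, zero_mul,
      sub_zero] at h
    refine Eq.mp (congrArg (fun f => HasSum f _) (funext fun n => ?_))
      (h.mul_left (p.pAt false : ℂ))
    simp only [hd]
    push_cast; ring
  have hpm : HasSum (fun n : ℕ =>
      ⟪fock n, ((p.kraus (true, false)).comp (A.comp (p.kraus (true, false)).adjoint))
        (fock n)⟫_ℂ) (p.pAt true * Y) := by
    simp_rw [inner_kraus_conj, normSq_krausCoef, krausSource]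
    refine (hasSum_nat_add_iff' 1).mp ?_
    rw [Finset.range_one, Finset.sum_singleton, hα0, mul_zero, Complex.ofReal_zero, zero_mul,
      sub_zero]
    refine Eq.mp (congrArg (fun f => HasSum f _) (funext fun n => ?_))
      (hY.hasSum.mul_left (p.pAt true : ℂ))
    simp only [Nat.add_sub_cancel, hd]
    push_cast; ring
  have hpp : HasSum (fun n : ℕ =>
      ⟪fock n, ((p.kraus (true, true)).comp (A.comp (p.kraus (true, true)).adjoint))
        (fock n)⟫_ℂ) (p.pAt true * (trace A - Y)) := by
    simp_rw [inner_kraus_conj, normSq_krausCoef, krausSource]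
    refine Eq.mp (congrArg (fun f => HasSum f _) (funext fun n => ?_))
      ((hA.hasSum.sub hY.hasSum).mul_left (p.pAt true : ℂ))
    simp only [hd]
    push_cast; ring
  constructor
  · rintro ⟨_ | _, _ | _⟩
    exacts [hmm.summable, hmp.summable, hpm.summable, hpp.summable]
  · have hp : (p.pAt false : ℂ) + p.pAt true = 1 := by exact_mod_cast p.pAt_add
    rw [Fintype.sum_prod_type]
    simp only [Fintype.sum_bool]
    simp only [trace] at hmm hmp hpm hpp ⊢
    rw [hmm.tsum_eq, hmp.tsum_eq, hpm.tsum_eq, hpp.tsum_eq]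
    linear_combination (∑' n : ℕ, ⟪fock n, A (fock n)⟫_ℂ) * hp

/-- The probability `Tr (W_t(ω) ρ W_t(ω)*)` that the first `t` outcomes are `ω_1, …, ω_t`. -/
def outcomeProb (ρ : DensityOperator) (t : ℕ) (ω : ℕ → Outcome) : ℝ :=
  (trace ((p.W ω t).comp (ρ.op.comp (p.W ω t).adjoint))).re

end MaserParams

/-- Existence of a probability measure on sequences with prescribed consistent probabilities of the
elementary cylinders. -/
theorem exists_measure_cylinder {R : Type} [Fintype R] [Nonempty R] [MeasurableSpace R]
    [DiscreteMeasurableSpace R] (q : ℕ → (ℕ → R) → ℝ)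
    (hdep : ∀ t ω ω', (∀ j < t, ω j = ω' j) → q t ω = q t ω')
    (hpos : ∀ t ω, 0 ≤ q t ω) (h0 : ∀ ω, q 0 ω = 1)
    (hsum : ∀ t ω, ∑ y, q (t + 1) (Function.update ω t y) = q t ω) :
    ∃ P : Measure (ℕ → R), IsProbabilityMeasure P ∧
      ∀ t ω, P {z | ∀ j < t, z j = ω j} = ENNReal.ofReal (q t ω) := by
  classical
  obtain ⟨r₀⟩ := ‹Nonempty R›
  -- conditional probability of the next outcome
  let w : ℕ → (ℕ → R) → R → ℝ := fun t ω y =>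
    if q t ω = 0 then (if y = r₀ then 1 else 0) else q (t + 1) (Function.update ω t y) / q t ω
  have w_nonneg : ∀ t ω y, 0 ≤ w t ω y := by
    intro t ω y
    simp only [w]
    split_ifs
    · exact zero_le_one
    · exact le_rfl
    · exact div_nonneg (hpos _ _) (hpos _ _)
  have w_sum : ∀ t ω, ∑ y, w t ω y = 1 := by
    intro t ω
    simp only [w]
    split_ifs with h
    · simp
    · rw [← Finset.sum_div, hsum, div_self h]
  have w_mul : ∀ t ω, q t ω * w t ω (ω t) = q (t + 1) ω := by
    intro t ω
    simp only [w, Function.update_eq_self]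
    split_ifs with h h'
    · rw [h, zero_mul]
      have := hsum t ω
      rw [h, Finset.sum_eq_zero_iff_of_nonneg (fun _ _ => hpos _ _)] at this
      simpa using (this (ω t) (Finset.mem_univ _)).symm
    · rw [h, zero_mul]
      have := hsum t ω
      rw [h, Finset.sum_eq_zero_iff_of_nonneg (fun _ _ => hpos _ _)] at this
      simpa using (this (ω t) (Finset.mem_univ _)).symm
    · field_simp
  let m : ℕ → (ℕ → R) → Measure R := fun t ω => ∑ y, ENNReal.ofReal (w t ω y) • Measure.dirac y
  have m_prob : ∀ t ω, IsProbabilityMeasure (m t ω) := by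
    intro t ω
    constructor
    simp only [m, Measure.finsetSum_apply, Measure.smul_apply, measure_univ, smul_eq_mul, mul_one]
    rw [← ENNReal.ofReal_sum_of_nonneg (fun _ _ => w_nonneg _ _ _), w_sum, ENNReal.ofReal_one]
  have m_single : ∀ t ω y, m t ω {y} = ENNReal.ofReal (w t ω y) := by
    intro t ω y
    simp only [m, Measure.finsetSum_apply, Measure.smul_apply, smul_eq_mul, Measure.dirac_apply,
      Set.indicator_apply, Set.mem_singleton_iff]
    simp
  -- the process is built with an additional dummy coordinate at the start
  let ext : (t : ℕ) → ((i : Finset.Iic t) → R) → (ℕ → R) := fun t h j =>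
    if hj : j + 1 ≤ t then h ⟨j + 1, Finset.mem_Iic.mpr hj⟩ else r₀
  let κ : (t : ℕ) → Kernel ((i : Finset.Iic t) → R) R := fun t =>
    { toFun := fun h => m t (ext t h)
      measurable' := measurable_of_finite _ }
  have hκ : ∀ t, IsMarkovKernel (κ t) := fun t => ⟨fun h => m_prob _ _⟩
  let Q : Measure (ℕ → R) := Kernel.trajMeasure (X := fun _ => R) (Measure.dirac r₀) κ
  have hQ : IsProbabilityMeasure Q := by dsimp only [Q]; infer_instance
  have w_dep : ∀ t ω ω' y, (∀ j < t, ω j = ω' j) → w t ω y = w t ω' y := by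
    intro t ω ω' y h
    simp only [w]
    rw [hdep t ω ω' h, hdep (t + 1) (Function.update ω t y) (Function.update ω' t y)]
    intro j hj
    rcases eq_or_ne j t with rfl | hjt
    · simp
    · simp [hjt, h j (by omega)]
  have hstep : ∀ t : ℕ, (Q.map (Preorder.frestrictLe t)) ⊗ₘ κ t =
      Q.map (fun x => (Preorder.frestrictLe t x, x (t + 1))) := fun t =>
    Kernel.map_frestrictLe_trajMeasure_compProd_eq_map_trajMeasure
  have hmeas : ∀ (t : ℕ) (ω : ℕ → R), MeasurableSet {z : ℕ → R | ∀ j < t, z j = ω j} := by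
    intro t ω
    have : {z : ℕ → R | ∀ j < t, z j = ω j} =
        ⋂ j ∈ Set.Iio t, (fun z : ℕ → R => z j) ⁻¹' {ω j} := by
      ext z; simp
    rw [this]
    exact MeasurableSet.biInter (Set.to_countable _)
      (fun j _ => measurable_pi_apply j (measurableSet_singleton _))
  have hsh : Measurable (fun (z : ℕ → R) (j : ℕ) => z (j + 1)) := by fun_prop
  refine ⟨Q.map (fun z j => z (j + 1)), Measure.isProbabilityMeasure_map hsh.aemeasurable,
    fun t => ?_⟩
  induction t with
  | zero =>
    intro ω
    have := Measure.isProbabilityMeasure_map (μ := Q) hsh.aemeasurable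
    simp [h0]
  | succ t ih =>
    intro ω
    rw [Measure.map_apply hsh (hmeas _ _)]
    have ih' := ih ω
    rw [Measure.map_apply hsh (hmeas _ _)] at ih'
    let B : Set ((i : Finset.Iic t) → R) := {h | ∀ j < t, ext t h j = ω j}
    have hB : MeasurableSet B := (Set.toFinite B).measurableSet
    have e1 : (fun (z : ℕ → R) (j : ℕ) => z (j + 1)) ⁻¹' {z | ∀ j < t, z j = ω j} =
        Preorder.frestrictLe t ⁻¹' B := by
      ext z
      simp only [Set.mem_preimage, Set.mem_ofPred_eq, B, ext]
      refine forall₂_congr (fun j hj => ?_)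
      rw [dif_pos (by omega)]
      rfl
    have e2 : (fun (z : ℕ → R) (j : ℕ) => z (j + 1)) ⁻¹' {z | ∀ j < t + 1, z j = ω j} =
        (fun x : ℕ → R => (Preorder.frestrictLe (π := fun _ => R) t x, x (t + 1))) ⁻¹'
          (B ×ˢ {ω t}) := by
      rw [Set.mk_preimage_prod, ← e1]
      ext z
      simp only [Set.mem_preimage, Set.mem_ofPred_eq, Set.mem_inter_iff, Set.mem_singleton_iff]
      constructor
      · exact fun h => ⟨fun j hj => h j (by omega), h t (by omega)⟩
      · rintro ⟨h, h'⟩ j hj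
        rcases (Nat.lt_succ_iff_lt_or_eq.mp hj) with hj | rfl
        · exact h j hj
        · exact h'
    rw [e2, ← Measure.map_apply (by fun_prop) (hB.prod (measurableSet_singleton _)), ← hstep,
      Measure.compProd_apply_prod hB (measurableSet_singleton _)]
    have hk : ∀ h ∈ B, κ t h {ω t} = ENNReal.ofReal (w t ω (ω t)) := by
      intro h hh
      change m t (ext t h) {ω t} = _
      rw [m_single, w_dep t (ext t h) ω _ hh]
    rw [setLIntegral_congr_fun hB hk, setLIntegral_const, Measure.map_apply (by fun_prop) hB,
      ← e1, ih', ← ENNReal.ofReal_mul (w_nonneg _ _ _), mul_comm, w_mul]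

namespace MaserParams

variable (p : MaserParams)

theorem W_congr {ω ω' : ℕ → Outcome} {t : ℕ} (h : ∀ j < t, ω j = ω' j) : p.W ω t = p.W ω' t := by
  induction t with
  | zero => rfl
  | succ t ih => rw [W, W, ih (fun j hj => h j (by omega)), h t (by omega)]

theorem isPositive_conj (ρ : DensityOperator) (T : Fock →L[ℂ] Fock) :
    (T.comp (ρ.op.comp T.adjoint)).IsPositive := ρ.isPositive.conj_adjoint T

theorem conj_W_succ (A : Fock →L[ℂ] Fock) (ω : ℕ → Outcome) (t : ℕ) :
    (p.W ω (t + 1)).comp (A.comp (p.W ω (t + 1)).adjoint) =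
      (p.kraus (ω t)).comp (((p.W ω t).comp (A.comp (p.W ω t).adjoint)).comp
        (p.kraus (ω t)).adjoint) := by
  rw [W, ContinuousLinearMap.adjoint_comp]
  rfl

theorem summable_conj_W (ρ : DensityOperator) (ω : ℕ → Outcome) (t : ℕ) :
    Summable (fun n : ℕ =>
      ⟪fock n, ((p.W ω t).comp (ρ.op.comp (p.W ω t).adjoint)) (fock n)⟫_ℂ) := by
  induction t with
  | zero =>
    have : (p.W ω 0).comp (ρ.op.comp (p.W ω 0).adjoint) = ρ.op := by
      rw [W, ContinuousLinearMap.adjoint_id]; rfl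
    rw [this]
    exact ρ.hasSum_trace.summable
  | succ t ih =>
    rw [conj_W_succ]
    exact (p.kraus_trace _ ih).1 _

theorem exists_outcomeLaw (ρ : DensityOperator) :
    ∃ P : Measure (ℕ → Outcome), IsProbabilityMeasure P ∧
      ∀ t ω, P {z | ∀ j < t, z j = ω j} = ENNReal.ofReal (p.outcomeProb ρ t ω) := by
  refine exists_measure_cylinder (p.outcomeProb ρ) ?_ ?_ ?_ ?_
  · intro t ω ω' h
    rw [outcomeProb, outcomeProb, p.W_congr h]
  · intro t ω
    rw [outcomeProb, trace, Complex.re_tsum (p.summable_conj_W ρ ω t)]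
    exact tsum_nonneg (fun n => (isPositive_conj ρ (p.W ω t)).re_inner_nonneg_right (fock n))
  · intro ω
    have : (p.W ω 0).comp (ρ.op.comp (p.W ω 0).adjoint) = ρ.op := by
      rw [W, ContinuousLinearMap.adjoint_id]; rfl
    rw [outcomeProb, this, trace, ρ.hasSum_trace.tsum_eq, Complex.one_re]
  · intro t ω
    have h : ∀ y, p.outcomeProb ρ (t + 1) (Function.update ω t y) =
        (trace ((p.kraus y).comp (((p.W ω t).comp (ρ.op.comp (p.W ω t).adjoint)).comp
          (p.kraus y).adjoint))).re := by
      intro y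
      rw [outcomeProb, conj_W_succ, Function.update_self,
        p.W_congr (ω := Function.update ω t y) (ω' := ω)]
      intro j hj
      simp [hj.ne]
    simp_rw [h]
    rw [outcomeProb, ← Complex.re_sum, (p.kraus_trace _ (p.summable_conj_W ρ ω t)).2]

/-- The law `ℙ^ρ` of the sequence of measurement outcomes when the initial state of the cavity is
`ρ`: the probability measure on `Ω = Outcome^ℕ` (with the σ-algebra generated by the cylinders) such
that `ℙ^ρ {z | z_1 = ω_1, …, z_t = ω_t} = Tr (W_t(ω) ρ W_t(ω)*)` for all `t` and `ω`. -/
def outcomeLaw (ρ : DensityOperator) : Measure (ℕ → Outcome) := (p.exists_outcomeLaw ρ).choose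

instance (ρ : DensityOperator) : IsProbabilityMeasure (p.outcomeLaw ρ) :=
  (p.exists_outcomeLaw ρ).choose_spec.1

theorem outcomeLaw_cylinder (ρ : DensityOperator) (t : ℕ) (ω : ℕ → Outcome) :
    p.outcomeLaw ρ {z | ∀ j < t, z j = ω j} = ENNReal.ofReal (p.outcomeProb ρ t ω) :=
  (p.exists_outcomeLaw ρ).choose_spec.2 t ω

/-! ### The Gibbs state -/

theorem norm_exp_le_one (hβ : 0 < p.β) (n : ℕ) :
    ‖((Real.exp (-p.β * p.ε * n) : ℝ) : ℂ)‖ ≤ 1 := by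
  rw [Complex.norm_real, Real.norm_of_nonneg (Real.exp_pos _).le, Real.exp_le_one_iff]
  have := mul_nonneg (mul_pos hβ p.ε_pos).le (Nat.cast_nonneg (α := ℝ) n)
  linarith

/-- The bounded operator `e^{-βεN}`, for `β > 0`. -/
def boltzmann (hβ : 0 < p.β) : Fock →L[ℂ] Fock :=
  ofSeqMap (funN (fun n => (Real.exp (-p.β * p.ε * n) : ℂ)))
    (sum_norm_sq_le _ (fun n => n) (p.norm_exp_le_one hβ) (fun _ _ _ _ h => h))

theorem boltzmann_apply (hβ : 0 < p.β) (ψ : Fock) (n : ℕ) :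
    p.boltzmann hβ ψ n = (Real.exp (-p.β * p.ε * n) : ℂ) * ψ n := rfl

theorem inner_boltzmann (hβ : 0 < p.β) (n : ℕ) :
    ⟪fock n, p.boltzmann hβ (fock n)⟫_ℂ = ((Real.exp (-p.β * p.ε) ^ n : ℝ) : ℂ) := by
  rw [inner_fock, boltzmann_apply, fock_apply, if_pos rfl, mul_one, ← Real.exp_nat_mul]
  congr 2
  ring

theorem hasSum_boltzmann (hβ : 0 < p.β) :
    HasSum (fun n : ℕ => ⟪fock n, p.boltzmann hβ (fock n)⟫_ℂ)
      (((1 - Real.exp (-p.β * p.ε))⁻¹ : ℝ) : ℂ) := by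
  simp_rw [inner_boltzmann]
  refine Complex.hasSum_ofReal.mpr (hasSum_geometric_of_lt_one (Real.exp_pos _).le ?_)
  rw [Real.exp_lt_one_iff]
  have := mul_pos hβ p.ε_pos
  linarith

theorem isPositive_boltzmann (hβ : 0 < p.β) : (p.boltzmann hβ).IsPositive := by
  rw [ContinuousLinearMap.isPositive_iff_complex]
  intro ψ
  have h : ⟪p.boltzmann hβ ψ, ψ⟫_ℂ =
      ((∑' n : ℕ, Real.exp (-p.β * p.ε * n) * ‖ψ n‖ ^ 2 : ℝ) : ℂ) := by
    rw [lp.inner_eq_tsum, Complex.ofReal_tsum]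
    refine tsum_congr (fun n => ?_)
    rw [boltzmann_apply]
    simp only [RCLike.inner_apply, map_mul, Complex.conj_ofReal, Complex.ofReal_mul]
    rw [mul_left_comm, Complex.mul_conj, Complex.normSq_eq_norm_sq]
  rw [h]
  refine ⟨by simp, ?_⟩
  simp only [RCLike.re_to_complex, Complex.ofReal_re]
  exact tsum_nonneg (fun n => by positivity)

/-- The Gibbs state `ρ_inv = e^{-βεN} / Tr (e^{-βεN})`, for `β > 0`. -/
def gibbs (hβ : 0 < p.β) : DensityOperator where
  op := (trace (p.boltzmann hβ))⁻¹ • p.boltzmann hβ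
  isPositive := by
    refine (p.isPositive_boltzmann hβ).smul_of_nonneg ?_
    rw [trace, (p.hasSum_boltzmann hβ).tsum_eq, ← Complex.ofReal_inv, inv_inv]
    rw [Complex.zero_le_real, sub_nonneg, Real.exp_le_one_iff]
    have := mul_pos hβ p.ε_pos
    linarith
  hasSum_trace := by
    have h := p.hasSum_boltzmann hβ
    have hne : trace (p.boltzmann hβ) ≠ 0 := by
      rw [trace, h.tsum_eq, Complex.ofReal_ne_zero]
      refine inv_ne_zero (sub_ne_zero.mpr (ne_of_gt ?_))
      rw [Real.exp_lt_one_iff]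
      have := mul_pos hβ p.ε_pos
      linarith
    have h2 := (h.summable.hasSum).mul_left (trace (p.boltzmann hβ))⁻¹
    change HasSum _ ((trace (p.boltzmann hβ))⁻¹ * trace (p.boltzmann hβ)) at h2
    rw [inv_mul_cancel₀ hne] at h2
    simpa only [smul_apply, inner_smul_right] using h2

end MaserParams

/-! ### Left shift and total variation -/

/-- The left shift `θ(ω)_t = ω_{t+1}` on sequences of outcomes. -/
def shift (ω : ℕ → Outcome) : ℕ → Outcome := fun t => ω (t + 1)

theorem measurable_shift : Measurable shift := by
  unfold shift
  fun_prop

/-- The total variation norm `‖μ - ν‖_TV` of the difference of two finite measures: the total mass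
`|μ - ν|(X)` of the total variation of the signed measure `μ - ν`. -/
def tvNorm {X : Type*} [MeasurableSpace X] (μ ν : Measure X) [IsFiniteMeasure μ]
    [IsFiniteMeasure ν] : ℝ≥0∞ :=
  (μ.toSignedMeasure - ν.toSignedMeasure).totalVariation Set.univ

end

end OneAtomMaser

/-!
The Kraus operators map each Fock vector to a multiple of a Fock vector, so the traces
`Tr (W_t(ω) ρ W_t(ω)*)` involve only the diagonal of `ρ` in the Fock basis, that is, the distribution
of the photon number (`trace_conj_W`). The law of the outcomes is therefore a mixture over `k` of the
laws `numberLaw k` with `k` initial photons (`outcomeLaw_eq_sum`), and the shift acts on the mixing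
distribution through a birth–death chain on `ℕ`, jumping down with probability `p_at(-) α_n` and up
with probability `p_at(+) α_{n+1}` (`map_shift_numberLaw`). Consequently the total variation distance
in the theorem is at most twice the `ℓ¹` distance between the photon number distribution after `t`
steps and the Gibbs distribution (`tvNorm_shift_le`), and it remains to show that the chain converges
to equilibrium in `ℓ¹`.

Non-resonance means that all `α_{n+1}` are positive (`α_succ_pos`), so that the chain is irreducible,
and the Gibbs distribution `w` satisfies detailed balance (`photonDist_gibbs_balance`). Hence, for an
initial distribution `w u`, the distribution after `t` steps is `w u_t`, where `u_t` is obtained by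
averaging `u` with the transition probabilities. If `u` is bounded, then `∑ w u_t²` is nonincreasing
in `t` and drops in each step by the `w`-mean of the variance of `u_t` after one step of the chain,
so these variances tend to `0` (`tendsto_stepVar`). The variance at `0` controls `u_t(1) - u_t(0)`,
because the chain stays at `0` with positive probability, and the variance at `n + 1` controls
`u_t(n+2) - u_t(n)`; thus `u_t` becomes constant (`tendsto_avg_iterate_sub`), and the constant is
the conserved mass. Dominated convergence gives the `ℓ¹` limit, and since the evolution is an `ℓ¹`
contraction, general initial distributions follow by cutting off their tails (`tendsto_evolve`).
-/

open MeasureTheory ProbabilityTheory Filter Topology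
open scoped ENNReal InnerProductSpace

namespace OneAtomMaser

/-! ### Birth–death chains on `ℕ` -/

/-- A birth–death chain on `ℕ`: from `n` it jumps to `n - 1` with probability `down n`, to `n + 1`
with probability `up n`, and stays at `n` otherwise. -/
structure BirthDeath where
  down : ℕ → ℝ
  up : ℕ → ℝ
  down_zero : down 0 = 0
  down_nonneg : ∀ n, 0 ≤ down n
  up_nonneg : ∀ n, 0 ≤ up n
  add_le_one : ∀ n, down n + up n ≤ 1

namespace BirthDeath

variable (c : BirthDeath)

/-- The transition operator on functions: `avg u n` is the mean of `u` after one step from `n`. -/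
def avg (u : ℕ → ℝ) (n : ℕ) : ℝ :=
  c.down n * u (n - 1) + (1 - c.down n - c.up n) * u n + c.up n * u (n + 1)

/-- The transition operator on (signed) distributions, the dual of `avg`. -/
def evolve (d : ℕ → ℝ) : ℕ → ℝ
  | 0 => (1 - c.down 0 - c.up 0) * d 0 + c.down 1 * d 1
  | n + 1 => c.up n * d n + (1 - c.down (n + 1) - c.up (n + 1)) * d (n + 1) +
      c.down (n + 2) * d (n + 2)

theorem down_le_one (n : ℕ) : c.down n ≤ 1 := by
  linarith [c.add_le_one n, c.up_nonneg n]

theorem up_le_one (n : ℕ) : c.up n ≤ 1 := by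
  linarith [c.add_le_one n, c.down_nonneg n]

theorem avg_const (x : ℝ) : c.avg (fun _ => x) = fun _ => x := by
  ext n
  simp only [avg]
  ring

theorem abs_avg_le {u : ℕ → ℝ} {M : ℝ} (hu : ∀ n, |u n| ≤ M) (n : ℕ) : |c.avg u n| ≤ M := by
  have h1 := abs_le.mp (hu (n - 1))
  have h2 := abs_le.mp (hu n)
  have h3 := abs_le.mp (hu (n + 1))
  have ha := c.down_nonneg n
  have hb := c.up_nonneg n
  have hc := c.add_le_one n
  rw [abs_le, avg]
  constructor <;> nlinarith

theorem abs_avg_iterate_le {u : ℕ → ℝ} {M : ℝ} (hu : ∀ n, |u n| ≤ M) (t n : ℕ) :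
    |c.avg^[t] u n| ≤ M := by
  induction t generalizing n with
  | zero => exact hu n
  | succ t ih => rw [Function.iterate_succ_apply']; exact c.abs_avg_le ih n

theorem _root_.HasSum.congr_terms {M : Type*} [AddCommMonoid M] [TopologicalSpace M]
    {f g : ℕ → M} {x : M} (h : HasSum f x) (e : ∀ n, g n = f n) : HasSum g x := by
  rwa [funext e]

theorem _root_.Summable.mul_of_abs_le {d g : ℕ → ℝ} {M : ℝ} (hd : Summable d)
    (hg : ∀ n, |g n| ≤ M) : Summable (fun n => d n * g n) := by
  refine Summable.of_norm_bounded (hd.abs.mul_right M) (fun n => ?_)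
  rw [Real.norm_eq_abs, abs_mul]
  exact mul_le_mul_of_nonneg_left (hg n) (abs_nonneg _)

/-- Duality between the evolution of distributions and of functions. -/
theorem hasSum_evolve_mul {d g : ℕ → ℝ} {M : ℝ} (hd : Summable d) (hg : ∀ n, |g n| ≤ M) :
    HasSum (fun n => c.evolve d n * g n) (∑' n, d n * c.avg g n) := by
  have hM : 0 ≤ M := (abs_nonneg _).trans (hg 0)
  have hbd : ∀ (x y : ℝ), 0 ≤ x → x ≤ 1 → |y| ≤ M → |x * y| ≤ M := fun x y h0 h1 hy => by
    rw [abs_mul, abs_of_nonneg h0]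
    nlinarith [abs_nonneg y]
  have hA : Summable (fun n => d n * (c.down n * g (n - 1))) :=
    hd.mul_of_abs_le fun n => hbd _ _ (c.down_nonneg n) (c.down_le_one n) (hg _)
  have hB : Summable (fun n => d n * (c.up n * g (n + 1))) :=
    hd.mul_of_abs_le fun n => hbd _ _ (c.up_nonneg n) (c.up_le_one n) (hg _)
  have hC : Summable (fun n => d n * ((1 - c.down n - c.up n) * g n)) :=
    hd.mul_of_abs_le fun n => hbd _ _ (by linarith [c.add_le_one n])
      (by linarith [c.down_nonneg n, c.up_nonneg n]) (hg _)
  have hA' := (hasSum_nat_add_iff' 1).mpr hA.hasSum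
  simp only [Finset.range_one, Finset.sum_singleton, c.down_zero, zero_mul, mul_zero, sub_zero,
    Nat.add_sub_cancel] at hA'
  have hB' : HasSum (fun n : ℕ => (match n with | 0 => 0 | k + 1 => c.up k * d k) * g n)
      (∑' n, d n * (c.up n * g (n + 1))) := by
    refine (hasSum_nat_add_iff' 1).mp ?_
    simp only [Finset.range_one, Finset.sum_singleton, zero_mul, sub_zero]
    exact hB.hasSum.congr_terms fun n => by ring
  have e : ∑' n, d n * c.avg g n = ∑' n, d n * (c.down n * g (n - 1)) +
      ∑' n, d n * ((1 - c.down n - c.up n) * g n) + ∑' n, d n * (c.up n * g (n + 1)) := by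
    rw [← hA.tsum_add hC, ← (hA.add hC).tsum_add hB]
    exact tsum_congr fun n => by rw [avg]; ring
  rw [e]
  refine ((hA'.add hC.hasSum).add hB').congr_terms fun n => ?_
  cases n with
  | zero => simp only [evolve]; ring
  | succ n => simp only [evolve]; ring

theorem hasSum_evolve {d : ℕ → ℝ} (hd : Summable d) : HasSum (c.evolve d) (∑' n, d n) := by
  have h := c.hasSum_evolve_mul (g := fun _ => 1) (M := 1) hd (by simp)
  simpa [avg_const] using h

theorem summable_evolve_iterate {d : ℕ → ℝ} (hd : Summable d) (t : ℕ) :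
    Summable (c.evolve^[t] d) := by
  induction t with
  | zero => exact hd
  | succ t ih => rw [Function.iterate_succ_apply']; exact (c.hasSum_evolve ih).summable

theorem tsum_evolve_iterate_mul {d g : ℕ → ℝ} {M : ℝ} (hd : Summable d) (hg : ∀ n, |g n| ≤ M)
    (t : ℕ) : ∑' n, c.evolve^[t] d n * g n = ∑' n, d n * c.avg^[t] g n := by
  induction t generalizing d with
  | zero => rfl
  | succ t ih =>
    rw [Function.iterate_succ_apply, ih (c.hasSum_evolve hd).summable, Function.iterate_succ_apply',
      (c.hasSum_evolve_mul hd (c.abs_avg_iterate_le hg t)).tsum_eq]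

theorem evolve_sub (d e : ℕ → ℝ) : c.evolve (d - e) = c.evolve d - c.evolve e := by
  ext n
  cases n <;> simp only [evolve, Pi.sub_apply] <;> ring

theorem evolve_iterate_sub (d e : ℕ → ℝ) (t : ℕ) :
    c.evolve^[t] (d - e) = c.evolve^[t] d - c.evolve^[t] e := by
  induction t with
  | zero => rfl
  | succ t ih => simp only [Function.iterate_succ_apply', ih, evolve_sub]

theorem abs_evolve_le (d : ℕ → ℝ) (n : ℕ) : |c.evolve d n| ≤ c.evolve (fun k => |d k|) n := by
  have hstay : ∀ k, 0 ≤ 1 - c.down k - c.up k := fun k => by linarith [c.add_le_one k]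
  cases n with
  | zero =>
    refine (abs_add_le _ _).trans (le_of_eq ?_)
    simp only [evolve, abs_mul, abs_of_nonneg (hstay _), abs_of_nonneg (c.down_nonneg _)]
  | succ n =>
    refine (abs_add_three _ _ _).trans (le_of_eq ?_)
    simp only [evolve, abs_mul, abs_of_nonneg (hstay _), abs_of_nonneg (c.down_nonneg _),
      abs_of_nonneg (c.up_nonneg _)]

/-- The evolution is a contraction of `ℓ¹`. -/
theorem tsum_abs_evolve_iterate_le {d : ℕ → ℝ} (hd : Summable d) (t : ℕ) :
    ∑' n, |c.evolve^[t] d n| ≤ ∑' n, |d n| := by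
  induction t with
  | zero => rfl
  | succ t ih =>
    refine le_trans ?_ ih
    have hs := c.summable_evolve_iterate hd t
    have h := c.hasSum_evolve hs.abs
    rw [← h.tsum_eq]
    refine Summable.tsum_le_tsum (fun n => ?_) (c.summable_evolve_iterate hd (t + 1)).abs h.summable
    rw [Function.iterate_succ_apply']
    exact c.abs_evolve_le _ n

/-! ### Convergence to equilibrium of birth–death chains -/

/-- By detailed balance, `avg` describes the evolution of densities with respect to `w`. -/
theorem evolve_mul_eq {w : ℕ → ℝ} (hw : ∀ n, w n * c.up n = w (n + 1) * c.down (n + 1))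
    (u : ℕ → ℝ) : c.evolve (fun n => w n * u n) = fun n => w n * c.avg u n := by
  ext n
  cases n with
  | zero =>
    simp only [evolve, avg, zero_add, c.down_zero]
    linear_combination -(u 1) * hw 0
  | succ n =>
    simp only [evolve, avg, Nat.add_sub_cancel]
    linear_combination u n * hw n - u (n + 2) * hw (n + 1)

theorem evolve_iterate_mul_eq {w : ℕ → ℝ}
    (hw : ∀ n, w n * c.up n = w (n + 1) * c.down (n + 1)) (u : ℕ → ℝ) (t : ℕ) :
    c.evolve^[t] (fun n => w n * u n) = fun n => w n * c.avg^[t] u n := by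
  induction t with
  | zero => rfl
  | succ t ih => rw [Function.iterate_succ_apply', ih, evolve_mul_eq c hw,
      Function.iterate_succ_apply']

/-- The variance of `u` after one step of the chain from `n`. -/
def stepVar (u : ℕ → ℝ) (n : ℕ) : ℝ := c.avg (fun k => u k ^ 2) n - c.avg u n ^ 2

theorem stepVar_eq (u : ℕ → ℝ) (n : ℕ) : c.stepVar u n =
    c.down n * c.up n * (u (n + 1) - u (n - 1)) ^ 2 +
    c.down n * (1 - c.down n - c.up n) * (u n - u (n - 1)) ^ 2 +
    c.up n * (1 - c.down n - c.up n) * (u (n + 1) - u n) ^ 2 := by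
  simp only [stepVar, avg]
  ring

theorem stepVar_nonneg (u : ℕ → ℝ) (n : ℕ) : 0 ≤ c.stepVar u n := by
  have ha := c.down_nonneg n
  have hb := c.up_nonneg n
  have hc : 0 ≤ 1 - c.down n - c.up n := by linarith [c.add_le_one n]
  rw [stepVar_eq]
  positivity

/-- The `ℓ²(w)` norm of the density decreases, in each step, by the mean of `stepVar`; as it is
bounded below, the variance after one step from any given position tends to `0`. -/
theorem tendsto_stepVar {w : ℕ → ℝ} (hw : ∀ n, w n * c.up n = w (n + 1) * c.down (n + 1))
    (hpos : ∀ n, 0 < w n) (hsum : Summable w) {u : ℕ → ℝ} {M : ℝ} (hu : ∀ n, |u n| ≤ M) (n : ℕ) :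
    Tendsto (fun t => c.stepVar (c.avg^[t] u) n) atTop (𝓝 0) := by
  have hM : 0 ≤ M := (abs_nonneg _).trans (hu 0)
  have hsq : ∀ t k, |c.avg^[t] u k ^ 2| ≤ M ^ 2 := fun t k => by
    rw [abs_pow]
    exact pow_le_pow_left₀ (abs_nonneg _) (c.abs_avg_iterate_le hu t k) 2
  set E : ℕ → ℝ := fun t => ∑' k, w k * c.avg^[t] u k ^ 2
  have hinv : c.evolve w = w := by
    have h := c.evolve_mul_eq hw (fun _ => 1)
    simpa [avg_const] using h
  have hdrop : ∀ t, HasSum (fun k => w k * c.stepVar (c.avg^[t] u) k) (E t - E (t + 1)) := by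
    intro t
    have h1 : ∑' k, w k * c.avg (fun j => c.avg^[t] u j ^ 2) k = E t := by
      rw [← (c.hasSum_evolve_mul hsum (hsq t)).tsum_eq, hinv]
    have h2 := (hsum.mul_of_abs_le (c.abs_avg_le (hsq t))).hasSum
    rw [h1] at h2
    have h3 := (hsum.mul_of_abs_le (hsq (t + 1))).hasSum
    refine (h2.sub h3).congr_terms fun k => ?_
    rw [stepVar, Function.iterate_succ_apply', mul_sub]
  have hnn : ∀ t k, 0 ≤ w k * c.stepVar (c.avg^[t] u) k := fun t k =>
    mul_nonneg (hpos k).le (c.stepVar_nonneg _ _)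
  have hanti : Antitone E := antitone_nat_of_succ_le fun t => by
    linarith [(hdrop t).nonneg (hnn t)]
  have hbdd : BddBelow (Set.range E) := ⟨0, by
    rintro _ ⟨t, rfl⟩
    exact tsum_nonneg fun k => mul_nonneg (hpos k).le (sq_nonneg _)⟩
  have hlim := tendsto_atTop_ciInf hanti hbdd
  have hdiff : Tendsto (fun t => E t - E (t + 1)) atTop (𝓝 0) := by
    simpa using hlim.sub (hlim.comp (tendsto_add_atTop_nat 1))
  have hz : Tendsto (fun t => w n * c.stepVar (c.avg^[t] u) n) atTop (𝓝 0) :=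
    squeeze_zero (fun t => hnn t n)
      (fun t => le_hasSum (hdrop t) n fun k _ => hnn t k) hdiff
  have := hz.const_mul (w n)⁻¹
  simpa [← mul_assoc, inv_mul_cancel₀ (hpos n).ne'] using this

theorem tendsto_of_mul_sq_le {x : ℝ} (hx : 0 < x) {f g : ℕ → ℝ} (h : ∀ t, x * f t ^ 2 ≤ g t)
    (hg : Tendsto g atTop (𝓝 0)) : Tendsto f atTop (𝓝 0) := by
  have h1 : Tendsto (fun t => f t ^ 2) atTop (𝓝 0) := by
    refine squeeze_zero (fun t => sq_nonneg _) (fun t => ?_) (by simpa using hg.const_mul x⁻¹)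
    rw [inv_mul_eq_div, le_div_iff₀ hx, mul_comm]
    exact h t
  have h2 := h1.sqrt
  simp only [Real.sqrt_sq_eq_abs, Real.sqrt_zero] at h2
  exact (tendsto_zero_iff_abs_tendsto_zero _).mpr h2

/-- The oscillation of the density disappears. Vanishing of `stepVar` at `0`, where the chain stays
with positive probability, compares the positions `0` and `1`; at `n + 1` it compares `n + 2` with
`n`. -/
theorem tendsto_avg_iterate_sub {w : ℕ → ℝ}
    (hw : ∀ n, w n * c.up n = w (n + 1) * c.down (n + 1))
    (hpos : ∀ n, 0 < w n) (hsum : Summable w) (hdown : ∀ n, 0 < c.down (n + 1))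
    (hup : ∀ n, 0 < c.up n) (hstay : c.up 0 < 1) {u : ℕ → ℝ} {M : ℝ} (hu : ∀ n, |u n| ≤ M)
    (n : ℕ) : Tendsto (fun t => c.avg^[t] u n - c.avg^[t] u 0) atTop (𝓝 0) := by
  induction n using Nat.twoStepInduction with
  | zero => simp
  | one =>
    refine tendsto_of_mul_sq_le (x := c.up 0 * (1 - c.up 0))
      (mul_pos (hup 0) (by linarith)) (fun t => ?_) (c.tendsto_stepVar hw hpos hsum hu 0)
    rw [stepVar_eq, c.down_zero]
    simp
  | more n ih _ =>
    have h : Tendsto (fun t => c.avg^[t] u (n + 2) - c.avg^[t] u n) atTop (𝓝 0) := by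
      refine tendsto_of_mul_sq_le (x := c.down (n + 1) * c.up (n + 1))
        (mul_pos (hdown n) (hup _)) (fun t => ?_) (c.tendsto_stepVar hw hpos hsum hu (n + 1))
      have ha := c.down_nonneg (n + 1)
      have hb := c.up_nonneg (n + 1)
      have hc : 0 ≤ 1 - c.down (n + 1) - c.up (n + 1) := by linarith [c.add_le_one (n + 1)]
      rw [stepVar_eq, Nat.add_sub_cancel, add_assoc _ (_ * _ : ℝ)]
      exact le_add_of_nonneg_right (by positivity)
    simpa using h.add ih

/-- Convergence to equilibrium for initial distributions with a bounded density. -/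
theorem tendsto_evolve_of_density {w : ℕ → ℝ}
    (hw : ∀ n, w n * c.up n = w (n + 1) * c.down (n + 1))
    (hpos : ∀ n, 0 < w n) (hsum : HasSum w 1) (hdown : ∀ n, 0 < c.down (n + 1))
    (hup : ∀ n, 0 < c.up n) (hstay : c.up 0 < 1) {u : ℕ → ℝ} {M : ℝ} (hu : ∀ n, |u n| ≤ M) :
    Tendsto (fun t => ∑' n, |c.evolve^[t] (fun k => w k * u k) n - (∑' k, w k * u k) * w n|)
      atTop (𝓝 0) := by
  have hosc := c.tendsto_avg_iterate_sub hw hpos hsum.summable hdown hup hstay hu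
  have hb := c.abs_avg_iterate_le hu
  set m := ∑' k, w k * u k with hm
  have hmass : ∀ t, HasSum (fun n => w n * c.avg^[t] u n) m := fun t => by
    have hs := hsum.summable.mul_of_abs_le hu
    have h := c.tsum_evolve_iterate_mul (g := fun _ => 1) (M := 1) hs (by simp) t
    have hone : c.avg^[t] (fun _ => 1) = fun _ => 1 :=
      Function.iterate_fixed (c.avg_const 1) t
    simp only [hone, mul_one, c.evolve_iterate_mul_eq hw] at h
    rw [hm, ← h]
    exact (hsum.summable.mul_of_abs_le (hb t)).hasSum
  have hdom : ∀ f : ℕ → ℕ → ℝ, (∀ n, Tendsto (fun t => f t n) atTop (𝓝 0)) →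
      (∀ t n, |f t n| ≤ 2 * M) → Tendsto (fun t => ∑' n, w n * f t n) atTop (𝓝 0) := by
    intro f h0 hf
    have := tendsto_tsum_of_dominated_convergence (𝓕 := atTop) (f := fun t n => w n * f t n)
      (g := fun _ => 0) (bound := fun n => w n * (2 * M)) (hsum.summable.mul_right _)
      (fun n => by simpa using (h0 n).const_mul (w n))
      (Eventually.of_forall fun t n => by
        rw [Real.norm_eq_abs, abs_mul, abs_of_pos (hpos n)]
        exact mul_le_mul_of_nonneg_left (hf t n) (hpos n).le)
    simpa using this
  have hzero : Tendsto (fun t => m - c.avg^[t] u 0) atTop (𝓝 0) := by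
    refine (hdom (fun t n => c.avg^[t] u n - c.avg^[t] u 0) hosc fun t n => ?_).congr fun t => ?_
    · exact (abs_sub _ _).trans (by linarith [hb t n, hb t 0])
    · have h := (hmass t).sub (hsum.mul_right (c.avg^[t] u 0))
      rw [one_mul] at h
      exact (h.congr_terms fun n => by ring).tsum_eq
  have hmM : |m| ≤ M := by
    refine abs_le.mpr ⟨?_, ?_⟩
    · rw [← one_mul (-M)]
      refine hasSum_le (fun n => ?_) (hsum.mul_right (-M)) (hmass 0)
      exact mul_le_mul_of_nonneg_left (abs_le.mp (hb 0 n)).1 (hpos n).le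
    · rw [← one_mul M]
      refine hasSum_le (fun n => ?_) (hmass 0) (hsum.mul_right M)
      exact mul_le_mul_of_nonneg_left (abs_le.mp (hb 0 n)).2 (hpos n).le
  refine (hdom (fun t n => |c.avg^[t] u n - m|) (fun n => ?_) fun t n => ?_).congr fun t => ?_
  · have h := ((hosc n).sub hzero).abs
    simpa using h
  · rw [abs_abs]
    exact (abs_sub _ _).trans (by linarith [hb t n])
  · refine tsum_congr fun n => ?_
    rw [c.evolve_iterate_mul_eq hw, mul_comm m, ← mul_sub, abs_mul, abs_of_pos (hpos n)]

/-- Convergence to equilibrium in `ℓ¹`. -/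
theorem tendsto_evolve {w : ℕ → ℝ} (hw : ∀ n, w n * c.up n = w (n + 1) * c.down (n + 1))
    (hpos : ∀ n, 0 < w n) (hsum : HasSum w 1) (hdown : ∀ n, 0 < c.down (n + 1))
    (hup : ∀ n, 0 < c.up n) (hstay : c.up 0 < 1) {d : ℕ → ℝ} (hd : HasSum d 1) :
    Tendsto (fun t => ∑' n, |c.evolve^[t] d n - w n|) atTop (𝓝 0) := by
  have hds := hd.summable
  -- a cut-off distribution has a bounded density, and contraction controls the tail for all times
  have htail : Tendsto (fun K => ∑' n, |d (n + K)|) atTop (𝓝 0) :=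
    tendsto_sum_nat_add fun n => |d n|
  refine tendsto_order.mpr ⟨fun x hx => Eventually.of_forall fun t =>
    hx.trans_le (tsum_nonneg fun n => abs_nonneg _), fun x hx => ?_⟩
  obtain ⟨K, hK⟩ := (htail.eventually_lt_const (show 0 < x / 3 by linarith)).exists
  set e : ℕ → ℝ := fun n => if n < K then d n else 0 with he
  set u : ℕ → ℝ := fun n => e n / w n with hu_def
  have hwu : (fun k => w k * u k) = e := by
    ext k
    exact mul_div_cancel₀ _ (hpos k).ne'
  obtain ⟨M, hM⟩ : ∃ M, ∀ n, |u n| ≤ M := by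
    refine ⟨∑ k ∈ Finset.range K, |u k|, fun n => ?_⟩
    by_cases hn : n < K
    · exact Finset.single_le_sum (f := fun k => |u k|) (fun k _ => abs_nonneg _)
        (Finset.mem_range.mpr hn)
    · have : u n = 0 := by simp [hu_def, he, hn]
      rw [this, abs_zero]
      exact Finset.sum_nonneg fun k _ => abs_nonneg _
  have hes : Summable e := summable_of_ne_finset_zero (s := Finset.range K) fun n hn => by
    simp only [he]
    rw [if_neg (by simpa using hn)]
  have hdist : ∑' n, |(d - e) n| < x / 3 := by
    have hs : Summable (fun n => |(d - e) n|) := (hds.sub hes).abs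
    rw [← hs.sum_add_tsum_nat_add K, Finset.sum_eq_zero, zero_add]
    · refine lt_of_eq_of_lt (tsum_congr fun n => ?_) hK
      simp [e]
    · intro n hn
      simp [e, Finset.mem_range.mp hn]
  have hmass : |(∑' n, e n) - 1| ≤ ∑' n, |(d - e) n| := by
    rw [← hd.tsum_eq, abs_sub_comm, ← hds.tsum_sub hes]
    exact norm_tsum_le_tsum_norm (f := d - e) (hds.sub hes).norm
  have hlim := c.tendsto_evolve_of_density hw hpos hsum hdown hup hstay hM
  rw [hwu] at hlim
  filter_upwards [hlim.eventually_lt_const (show 0 < x / 3 by linarith)] with t ht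
  set m := ∑' k, e k with hm
  have s1 : Summable (fun n => |c.evolve^[t] (d - e) n|) :=
    (c.summable_evolve_iterate (hds.sub hes) t).abs
  have s2 : Summable (fun n => |c.evolve^[t] e n - m * w n|) :=
    ((c.summable_evolve_iterate hes t).sub (hsum.summable.mul_left m)).abs
  have s3 : HasSum (fun n => |m - 1| * w n) |m - 1| := by simpa using hsum.mul_left |m - 1|
  have s4 : Summable (fun n => |c.evolve^[t] d n - w n|) :=
    ((c.summable_evolve_iterate hds t).sub hsum.summable).abs
  have hle := Summable.tsum_le_tsum (fun n => ?_) s4 ((s1.add s2).add s3.summable)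
  · rw [(s1.add s2).tsum_add s3.summable, s1.tsum_add s2, s3.tsum_eq] at hle
    have := c.tsum_abs_evolve_iterate_le (hds.sub hes) t
    change ∑' n, |c.evolve^[t] (d - e) n| ≤ ∑' n, |(d - e) n| at this
    linarith
  · rw [evolve_iterate_sub]
    have h : |m - 1| * w n = |m * w n - w n| := by
      rw [← sub_one_mul, abs_mul, abs_of_pos (hpos n)]
    rw [h]
    refine le_trans (le_of_eq ?_) (abs_add_three _ _ _)
    congr 1
    simp only [Pi.sub_apply]
    ring

end BirthDeath

/-! ### Measures on sequences and the total variation norm -/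

theorem measurableSet_cylinder {R : Type*} [Finite R] [MeasurableSpace R]
    [DiscreteMeasurableSpace R] (t : ℕ) (ω : ℕ → R) :
    MeasurableSet {z : ℕ → R | ∀ j < t, z j = ω j} := by
  have : {z : ℕ → R | ∀ j < t, z j = ω j} =
      ⋂ j ∈ Set.Iio t, (fun z : ℕ → R => z j) ⁻¹' {ω j} := by
    ext z; simp
  rw [this]
  exact MeasurableSet.biInter (Set.to_countable _)
    (fun j _ => measurable_pi_apply j (measurableSet_singleton _))

/-- Finite measures on sequences in a finite set are determined by the elementary cylinders. -/
theorem ext_of_cylinder {R : Type*} [Finite R] [MeasurableSpace R] [DiscreteMeasurableSpace R]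
    {P Q : Measure (ℕ → R)} [IsFiniteMeasure Q]
    (h : ∀ (t : ℕ) (ω : ℕ → R), P {z | ∀ j < t, z j = ω j} = Q {z | ∀ j < t, z j = ω j}) : P = Q := by
  classical
  have hlim : ∀ S : Measure (ℕ → R),
      (∀ n, S.map (Preorder.frestrictLe n) = Q.map (Finset.Iic n).restrict) →
      IsProjectiveLimit S (fun I : Finset ℕ => Q.map I.restrict) := by
    intro S hS
    refine (isProjectiveLimit_nat_iff (X := fun _ => R) ?_ S).mpr hS
    intro I J hJI
    rw [Measure.map_map (by fun_prop) (by fun_prop)]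
    rfl
  have hQ := hlim Q fun n => rfl
  refine IsProjectiveLimit.unique (hlim P fun n => ?_) hQ
  refine Measure.ext_iff_singleton.mpr fun x => ?_
  rw [Measure.map_apply (by fun_prop) (measurableSet_singleton _),
    Measure.map_apply (by fun_prop) (measurableSet_singleton _)]
  have e : (Preorder.frestrictLe (π := fun _ => R) n) ⁻¹' {x} = {z : ℕ → R | ∀ j < n + 1, z j =
      (if hj : j ≤ n then x ⟨j, Finset.mem_Iic.mpr hj⟩ else x ⟨n, Finset.mem_Iic.mpr le_rfl⟩)} := by
    ext z
    simp only [Set.mem_preimage, Set.mem_singleton_iff, Set.mem_ofPred_eq]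
    constructor
    · rintro rfl j hj
      rw [dif_pos (by omega)]
      rfl
    · intro hz
      ext ⟨j, hj⟩
      have hj' := Finset.mem_Iic.mp hj
      have := hz j (by omega)
      rw [dif_pos hj'] at this
      exact this
  change P (Preorder.frestrictLe (π := fun _ => R) n ⁻¹' {x}) =
    Q (Preorder.frestrictLe (π := fun _ => R) n ⁻¹' {x})
  rw [e]
  exact h (n + 1) fun j =>
    if hj : j ≤ n then x ⟨j, Finset.mem_Iic.mpr hj⟩ else x ⟨n, Finset.mem_Iic.mpr le_rfl⟩

/-- By the Hahn decomposition, the total variation norm is at most twice the largest difference of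
the measures of a set. -/
theorem tvNorm_le {X : Type*} [MeasurableSpace X] (μ ν : Measure X) [IsFiniteMeasure μ]
    [IsFiniteMeasure ν] {x : ℝ} (h : ∀ A, MeasurableSet A → |μ.real A - ν.real A| ≤ x) :
    tvNorm μ ν ≤ ENNReal.ofReal (2 * x) := by
  obtain ⟨i, hi₁, hi₂, hi₃, hpos, hneg⟩ :=
    (μ.toSignedMeasure - ν.toSignedMeasure).toJordanDecomposition_spec
  have hx : 0 ≤ x := (abs_nonneg _).trans (h _ MeasurableSet.empty)
  rw [tvNorm, SignedMeasure.totalVariation, Measure.add_apply, hpos, hneg, two_mul,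
    ENNReal.ofReal_add hx hx]
  refine add_le_add ?_ ?_
  · rw [← ENNReal.ofReal_toReal (measure_ne_top _ Set.univ)]
    refine ENNReal.ofReal_le_ofReal ?_
    rw [← measureReal_def, SignedMeasure.toMeasureOfZeroLE_real_apply _ hi₂ hi₁ MeasurableSet.univ,
      Set.inter_univ, Measure.toSignedMeasure_sub_apply hi₁]
    exact (le_abs_self _).trans (h i hi₁)
  · rw [← ENNReal.ofReal_toReal (measure_ne_top _ Set.univ)]
    refine ENNReal.ofReal_le_ofReal ?_
    rw [← measureReal_def,
      SignedMeasure.toMeasureOfLEZero_real_apply _ hi₃ hi₁.compl MeasurableSet.univ,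
      Set.inter_univ, Measure.toSignedMeasure_sub_apply hi₁.compl]
    exact (neg_le_abs _).trans (h _ hi₁.compl)

namespace MaserParams

variable (p : MaserParams)

/-! ### The photon number chain -/

/-- The photon number after the outcome `y`, when it is `k` before. -/
def target : Outcome → ℕ → ℕ
  | (false, false), k => k
  | (false, true), k => k - 1
  | (true, false), k => k + 1
  | (true, true), k => k

/-- The probability of the outcome `y` in presence of `k` photons. -/
noncomputable def weight : Outcome → ℕ → ℝ
  | (false, false), k => p.pAt false * (1 - p.α k)
  | (false, true), k => p.pAt false * p.α k
  | (true, false), k => p.pAt true * p.α (k + 1)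
  | (true, true), k => p.pAt true * (1 - p.α (k + 1))

/-- The probability of the outcomes `ω 0, …, ω (t - 1)` when there are initially `k` photons. -/
noncomputable def likelihood : ℕ → (ℕ → Outcome) → ℕ → ℝ
  | 0, _, _ => 1
  | t + 1, ω, k => p.weight (ω 0) k * likelihood t (shift ω) (target (ω 0) k)

theorem α_zero : p.α 0 = 0 := by simp [α]

/-- The Markov chain of the photon number, when the outcomes are disregarded. -/
noncomputable def photonChain : BirthDeath where
  down n := p.pAt false * p.α n
  up n := p.pAt true * p.α (n + 1)
  down_zero := by rw [α_zero, mul_zero]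
  down_nonneg n := mul_nonneg (p.pAt_nonneg _) (p.α_nonneg _)
  up_nonneg n := mul_nonneg (p.pAt_nonneg _) (p.α_nonneg _)
  add_le_one n := by
    rw [← p.pAt_add]
    exact add_le_add (mul_le_of_le_one_right (p.pAt_nonneg _) (p.α_le_one _))
      (mul_le_of_le_one_right (p.pAt_nonneg _) (p.α_le_one _))

theorem sum_weight_mul (g : ℕ → ℝ) (k : ℕ) :
    ∑ y, p.weight y k * g (target y k) = p.photonChain.avg g k := by
  rw [Fintype.sum_prod_type]
  simp only [Fintype.sum_bool, weight, target, BirthDeath.avg, photonChain]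
  linear_combination g k * p.pAt_add

theorem weight_nonneg (y : Outcome) (k : ℕ) : 0 ≤ p.weight y k := by
  have h (n : ℕ) : 0 ≤ 1 - p.α n := sub_nonneg.mpr (p.α_le_one n)
  rcases y with ⟨_ | _, _ | _⟩
  exacts [mul_nonneg (p.pAt_nonneg _) (h _), mul_nonneg (p.pAt_nonneg _) (p.α_nonneg _),
    mul_nonneg (p.pAt_nonneg _) (p.α_nonneg _), mul_nonneg (p.pAt_nonneg _) (h _)]

theorem sum_weight (k : ℕ) : ∑ y, p.weight y k = 1 := by
  have h := p.sum_weight_mul (fun _ => 1) k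
  simpa [BirthDeath.avg_const] using h

theorem weight_le_one (y : Outcome) (k : ℕ) : p.weight y k ≤ 1 := by
  rw [← p.sum_weight k]
  exact Finset.single_le_sum (fun z _ => p.weight_nonneg z k) (Finset.mem_univ y)

theorem likelihood_nonneg (t : ℕ) (ω : ℕ → Outcome) (k : ℕ) : 0 ≤ p.likelihood t ω k := by
  induction t generalizing ω k with
  | zero => exact zero_le_one
  | succ t ih => exact mul_nonneg (p.weight_nonneg _ _) (ih _ _)

theorem likelihood_le_one (t : ℕ) (ω : ℕ → Outcome) (k : ℕ) : p.likelihood t ω k ≤ 1 := by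
  induction t generalizing ω k with
  | zero => exact le_rfl
  | succ t ih => exact mul_le_one₀ (p.weight_le_one _ _) (p.likelihood_nonneg _ _ _) (ih _ _)

theorem likelihood_congr {t : ℕ} {ω ω' : ℕ → Outcome} (h : ∀ j < t, ω j = ω' j) (k : ℕ) :
    p.likelihood t ω k = p.likelihood t ω' k := by
  induction t generalizing ω ω' k with
  | zero => rfl
  | succ t ih =>
    rw [likelihood, likelihood, h 0 (by omega),
      ih (ω := shift ω) (ω' := shift ω') fun j hj => h (j + 1) (by omega)]

theorem shift_update_succ (ω : ℕ → Outcome) (t : ℕ) (y : Outcome) :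
    shift (Function.update ω (t + 1) y) = Function.update (shift ω) t y := by
  ext1 j
  simp [shift, Function.update_apply]

theorem sum_likelihood_update (t : ℕ) (ω : ℕ → Outcome) (k : ℕ) :
    ∑ y, p.likelihood (t + 1) (Function.update ω t y) k = p.likelihood t ω k := by
  induction t generalizing ω k with
  | zero => simp [likelihood, sum_weight]
  | succ t ih =>
    rw [likelihood, ← ih, Finset.mul_sum]
    refine Finset.sum_congr rfl fun y _ => ?_
    rw [likelihood, shift_update_succ, Function.update_of_ne (by omega)]

theorem exists_numberLaw (k : ℕ) : ∃ P : Measure (ℕ → Outcome), IsProbabilityMeasure P ∧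
    ∀ t ω, P {z | ∀ j < t, z j = ω j} = ENNReal.ofReal (p.likelihood t ω k) :=
  exists_measure_cylinder (fun t ω => p.likelihood t ω k)
    (fun _ _ _ h => p.likelihood_congr h k) (fun t ω => p.likelihood_nonneg t ω k) (fun _ => rfl)
    (fun t ω => p.sum_likelihood_update t ω k)

/-- The law of the outcomes when there are initially `k` photons. -/
noncomputable def numberLaw (k : ℕ) : Measure (ℕ → Outcome) := (p.exists_numberLaw k).choose

instance (k : ℕ) : IsProbabilityMeasure (p.numberLaw k) := (p.exists_numberLaw k).choose_spec.1

theorem numberLaw_cylinder (k t : ℕ) (ω : ℕ → Outcome) :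
    p.numberLaw k {z | ∀ j < t, z j = ω j} = ENNReal.ofReal (p.likelihood t ω k) :=
  (p.exists_numberLaw k).choose_spec.2 t ω

/-- The Markov property: after the first outcome, the experiment starts afresh. -/
theorem map_shift_numberLaw (k : ℕ) : (p.numberLaw k).map shift =
    ∑ y, ENNReal.ofReal (p.weight y k) • p.numberLaw (target y k) := by
  have hfin : IsFiniteMeasure
      (∑ y, ENNReal.ofReal (p.weight y k) • p.numberLaw (target y k)) := by
    constructor
    simp only [Measure.finsetSum_apply, Measure.smul_apply, measure_univ, smul_eq_mul, mul_one]
    exact ENNReal.sum_lt_top.mpr fun _ _ => ENNReal.ofReal_lt_top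
  refine ext_of_cylinder fun t ω => ?_
  -- the sequence with first outcome `y`, followed by `ω`
  let cons : Outcome → ℕ → Outcome := fun y j => Nat.casesOn j y ω
  have hunion : shift ⁻¹' {z | ∀ j < t, z j = ω j} =
      ⋃ y, {z | ∀ j < t + 1, z j = cons y j} := by
    ext z
    simp only [Set.mem_preimage, Set.mem_ofPred_eq, Set.mem_iUnion]
    constructor
    · intro h
      refine ⟨z 0, fun j hj => ?_⟩
      cases j with
      | zero => rfl
      | succ j => exact h j (by omega)
    · rintro ⟨y, hy⟩ j hj
      exact hy (j + 1) (by omega)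
  have hdisj : Pairwise (Function.onFun Disjoint
      fun y => {z : ℕ → Outcome | ∀ j < t + 1, z j = cons y j}) := by
    intro y y' hyy
    refine Set.disjoint_left.mpr fun z hz hz' => hyy ?_
    exact (hz 0 (by omega)).symm.trans (hz' 0 (by omega))
  rw [Measure.map_apply measurable_shift (measurableSet_cylinder t ω), hunion,
    measure_iUnion hdisj fun y => measurableSet_cylinder _ _, tsum_fintype]
  simp only [Measure.finsetSum_apply, Measure.smul_apply, smul_eq_mul, numberLaw_cylinder]
  refine Finset.sum_congr rfl fun y _ => ?_
  rw [← ENNReal.ofReal_mul (p.weight_nonneg _ _)]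
  rfl

theorem numberLaw_preimage_shift_iterate {A : Set (ℕ → Outcome)} (hA : MeasurableSet A)
    (t k : ℕ) : (p.numberLaw k).real (shift^[t] ⁻¹' A) =
      p.photonChain.avg^[t] (fun j => (p.numberLaw j).real A) k := by
  induction t generalizing k with
  | zero => rfl
  | succ t ih =>
    have hA' : MeasurableSet (shift^[t] ⁻¹' A) := measurable_shift.iterate t hA
    rw [Function.iterate_succ, Set.preimage_comp, measureReal_def,
      ← Measure.map_apply measurable_shift hA', map_shift_numberLaw, Function.iterate_succ_apply',
      ← sum_weight_mul]
    simp only [Measure.finsetSum_apply, Measure.smul_apply, smul_eq_mul]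
    rw [ENNReal.toReal_sum fun y _ => ENNReal.mul_ne_top ENNReal.ofReal_ne_top (measure_ne_top _ _)]
    refine Finset.sum_congr rfl fun y _ => ?_
    rw [ENNReal.toReal_mul, ENNReal.toReal_ofReal (p.weight_nonneg _ _), ← measureReal_def, ih]

/-! ### Reduction of the law of the outcomes to the photon number chain -/

/-- Reindexing the diagonal of `V_y A V_y*` by the photon number before the outcome `y`. -/
theorem tsum_normSq_krausCoef_mul {F G : ℕ → ℂ} (hF : Summable F) {M : ℝ} (hG : ∀ n, ‖G n‖ ≤ M)
    (y : Outcome) :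
    ∑' n, ((‖p.krausCoef y n‖ ^ 2 : ℝ) : ℂ) * F (krausSource y n) * G n =
      ∑' k, F k * ((p.weight y k : ℂ) * G (target y k)) := by
  have hs : Summable (fun k => F k * ((p.weight y k : ℂ) * G (target y k))) := by
    refine Summable.of_norm_bounded (hF.norm.mul_right M) fun k => ?_
    rw [norm_mul, norm_mul, Complex.norm_real, Real.norm_of_nonneg (p.weight_nonneg y k)]
    refine mul_le_mul_of_nonneg_left ?_ (norm_nonneg _)
    exact (mul_le_of_le_one_left (norm_nonneg _) (p.weight_le_one y k)).trans (hG _)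
  simp_rw [normSq_krausCoef]
  rcases y with ⟨_ | _, _ | _⟩
  · exact tsum_congr fun n => by simp only [krausSource, weight, target]; ring
  · rw [hs.tsum_eq_zero_add]
    simp only [krausSource, weight, target, α_zero, mul_zero, Complex.ofReal_zero, zero_mul,
      zero_add, Nat.add_sub_cancel]
    exact tsum_congr fun n => by ring
  · have h : HasSum (fun n => ((p.pAt true * p.α n : ℝ) : ℂ) * F (n - 1) * G n)
        (∑' k, F k * ((p.weight (true, false) k : ℂ) * G (target (true, false) k))) := by
      refine (hasSum_nat_add_iff' 1).mp ?_
      simp only [Finset.range_one, Finset.sum_singleton, α_zero, mul_zero, Complex.ofReal_zero,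
        zero_mul, sub_zero, Nat.add_sub_cancel]
      refine hs.hasSum.congr_terms fun n => ?_
      simp only [weight, target]
      ring
    exact h.tsum_eq
  · exact tsum_congr fun n => by simp only [krausSource, weight, target]; ring

theorem W_succ_eq_comp (ω : ℕ → Outcome) (t : ℕ) :
    p.W ω (t + 1) = (p.W (shift ω) t).comp (p.kraus (ω 0)) := by
  induction t with
  | zero => rfl
  | succ t ih => rw [W, ih, W, ContinuousLinearMap.comp_assoc]; rfl

/-- The traces which define the law of the outcomes depend on the state only through its diagonal
elements in the Fock basis. -/
theorem trace_conj_W (A : Fock →L[ℂ] Fock) (hA : Summable fun n : ℕ => ⟪fock n, A (fock n)⟫_ℂ)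
    (t : ℕ) (ω : ℕ → Outcome) : trace ((p.W ω t).comp (A.comp (p.W ω t).adjoint)) =
      ∑' k, ⟪fock k, A (fock k)⟫_ℂ * (p.likelihood t ω k : ℂ) := by
  induction t generalizing A ω with
  | zero =>
    have : (p.W ω 0).comp (A.comp (p.W ω 0).adjoint) = A := by
      rw [W, ContinuousLinearMap.adjoint_id]; rfl
    simp [this, trace, likelihood]
  | succ t ih =>
    have h : (p.W ω (t + 1)).comp (A.comp (p.W ω (t + 1)).adjoint) =
        (p.W (shift ω) t).comp (((p.kraus (ω 0)).comp (A.comp (p.kraus (ω 0)).adjoint)).comp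
          (p.W (shift ω) t).adjoint) := by
      rw [W_succ_eq_comp, ContinuousLinearMap.adjoint_comp]; rfl
    rw [h, ih _ ((p.kraus_trace A hA).1 _)]
    simp_rw [inner_kraus_conj]
    rw [p.tsum_normSq_krausCoef_mul hA (M := 1) (G := fun n => (p.likelihood t (shift ω) n : ℂ))]
    · simp [likelihood]
    · intro n
      rw [Complex.norm_real, Real.norm_of_nonneg (p.likelihood_nonneg _ _ _)]
      exact p.likelihood_le_one _ _ _

end MaserParams

/-- The distribution of the photon number in the state `ρ`. -/
noncomputable def DensityOperator.photonDist (ρ : DensityOperator) (n : ℕ) : ℝ :=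
  (⟪fock n, ρ.op (fock n)⟫_ℂ).re

theorem DensityOperator.photonDist_nonneg (ρ : DensityOperator) (n : ℕ) : 0 ≤ ρ.photonDist n :=
  ρ.isPositive.re_inner_nonneg_right (fock n)

theorem DensityOperator.hasSum_photonDist (ρ : DensityOperator) : HasSum ρ.photonDist 1 :=
  Complex.hasSum_re ρ.hasSum_trace

namespace MaserParams

variable (p : MaserParams)

theorem outcomeProb_eq (ρ : DensityOperator) (t : ℕ) (ω : ℕ → Outcome) :
    p.outcomeProb ρ t ω = ∑' k, ρ.photonDist k * p.likelihood t ω k := by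
  have hs : Summable fun k => ⟪fock k, ρ.op (fock k)⟫_ℂ * (p.likelihood t ω k : ℂ) := by
    refine Summable.of_norm_bounded ρ.hasSum_trace.summable.norm fun k => ?_
    rw [norm_mul, Complex.norm_real, Real.norm_of_nonneg (p.likelihood_nonneg _ _ _)]
    exact mul_le_of_le_one_right (norm_nonneg _) (p.likelihood_le_one _ _ _)
  rw [outcomeProb, trace_conj_W p _ ρ.hasSum_trace.summable, Complex.re_tsum hs]
  exact tsum_congr fun k => Complex.re_mul_ofReal _ _

/-- The law of the outcomes is the mixture of the laws with a sharp initial photon number. -/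
theorem outcomeLaw_eq_sum (ρ : DensityOperator) :
    p.outcomeLaw ρ = Measure.sum fun k => ENNReal.ofReal (ρ.photonDist k) • p.numberLaw k := by
  symm
  refine ext_of_cylinder fun t ω => ?_
  have hnn : ∀ k, 0 ≤ ρ.photonDist k * p.likelihood t ω k := fun k =>
    mul_nonneg (ρ.photonDist_nonneg k) (p.likelihood_nonneg _ _ _)
  have hs : Summable fun k => ρ.photonDist k * p.likelihood t ω k :=
    ρ.hasSum_photonDist.summable.mul_of_abs_le (M := 1) fun k => by
      rw [abs_of_nonneg (p.likelihood_nonneg _ _ _)]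
      exact p.likelihood_le_one _ _ _
  rw [outcomeLaw_cylinder, outcomeProb_eq, ENNReal.ofReal_tsum_of_nonneg hnn hs,
    Measure.sum_apply _ (measurableSet_cylinder t ω)]
  refine tsum_congr fun k => ?_
  rw [Measure.smul_apply, smul_eq_mul, numberLaw_cylinder,
    ENNReal.ofReal_mul (ρ.photonDist_nonneg k)]

theorem outcomeLaw_real (ρ : DensityOperator) {A : Set (ℕ → Outcome)} (hA : MeasurableSet A) :
    (p.outcomeLaw ρ).real A = ∑' k, ρ.photonDist k * (p.numberLaw k).real A := by
  rw [measureReal_def, outcomeLaw_eq_sum, Measure.sum_apply _ hA, ENNReal.tsum_toReal_eq]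
  · refine tsum_congr fun k => ?_
    rw [Measure.smul_apply, smul_eq_mul, ENNReal.toReal_mul,
      ENNReal.toReal_ofReal (ρ.photonDist_nonneg k), measureReal_def]
  · exact fun k => ENNReal.mul_ne_top ENNReal.ofReal_ne_top (measure_ne_top (p.numberLaw k) A)

theorem tvNorm_shift_le (ρ σ : DensityOperator) (t : ℕ) :
    tvNorm ((p.outcomeLaw ρ).map shift^[t]) (p.outcomeLaw σ) ≤ ENNReal.ofReal
      (2 * ∑' n, |p.photonChain.evolve^[t] ρ.photonDist n - σ.photonDist n|) := by
  refine tvNorm_le _ _ fun A hA => ?_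
  have hg : ∀ n, |(p.numberLaw n).real A| ≤ 1 := fun n => by
    rw [abs_of_nonneg measureReal_nonneg]
    exact measureReal_le_one
  have hρ := p.photonChain.summable_evolve_iterate ρ.hasSum_photonDist.summable t
  have hσ := σ.hasSum_photonDist.summable
  rw [map_measureReal_apply (measurable_shift.iterate t) hA,
    outcomeLaw_real p ρ (measurable_shift.iterate t hA), outcomeLaw_real p σ hA]
  simp_rw [numberLaw_preimage_shift_iterate p hA]
  rw [← p.photonChain.tsum_evolve_iterate_mul ρ.hasSum_photonDist.summable hg,
    ← (hρ.mul_of_abs_le hg).tsum_sub (hσ.mul_of_abs_le hg)]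
  have hsum := ((hρ.mul_of_abs_le hg).sub (hσ.mul_of_abs_le hg)).norm
  refine (norm_tsum_le_tsum_norm hsum).trans (Summable.tsum_le_tsum (fun n => ?_) hsum
    (hρ.sub hσ).abs)
  rw [← sub_mul, Real.norm_eq_abs, abs_mul]
  exact mul_le_of_le_one_right (abs_nonneg _) (hg n)

/-! ### Non-resonance and detailed balance -/

/-- The transition probability vanishes only at a Rabi resonance. -/
theorem α_succ_pos (hres : p.NonResonant) (n : ℕ) : 0 < p.α (n + 1) := by
  have hξ := p.ξ_pos
  have hη := p.η_nonneg
  have hq : 0 < p.ξ * ((n + 1 : ℕ) : ℝ) + p.η := by positivity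
  have hsin : Real.sin (Real.pi * √(p.ξ * ((n + 1 : ℕ) : ℝ) + p.η)) ≠ 0 := by
    rw [Ne, Real.sin_eq_zero_iff]
    rintro ⟨k, hk⟩
    rw [mul_comm (k : ℝ)] at hk
    have hk' := mul_left_cancel₀ Real.pi_ne_zero hk
    have hkpos : 0 < k := by
      have := Real.sqrt_pos.mpr hq
      rw [← hk'] at this
      exact_mod_cast this
    lift k to ℕ using hkpos.le
    refine hres (n + 1) ⟨Nat.succ_pos n, k, by exact_mod_cast hkpos, ?_⟩
    rw [← Real.sq_sqrt hq.le, ← hk', Int.cast_natCast]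
  have := Real.sqrt_pos.mpr hq
  have := Real.sqrt_pos.mpr hξ
  have hS : p.S ((n + 1 : ℕ) : ℝ) ≠ 0 := by
    rw [S]
    exact mul_ne_zero this.ne' (div_ne_zero hsin (Real.sqrt_pos.mpr hq).ne')
  unfold α
  positivity

theorem pAt_pos (σ : Bool) : 0 < p.pAt σ := by
  cases σ <;> simp only [pAt] <;> positivity

theorem photonDist_gibbs (hβ : 0 < p.β) (n : ℕ) :
    (p.gibbs hβ).photonDist n = (1 - Real.exp (-p.β * p.ε)) * Real.exp (-p.β * p.ε) ^ n := by
  rw [DensityOperator.photonDist, gibbs]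
  simp only [smul_apply, inner_smul_right]
  rw [inner_boltzmann, trace, (p.hasSum_boltzmann hβ).tsum_eq, ← Complex.ofReal_inv, inv_inv,
    ← Complex.ofReal_mul, Complex.ofReal_re]

/-- The Gibbs distribution satisfies detailed balance, because `p_at(+) = e^{-βε} p_at(-)`. -/
theorem photonDist_gibbs_balance (hβ : 0 < p.β) (n : ℕ) :
    (p.gibbs hβ).photonDist n * p.photonChain.up n =
      (p.gibbs hβ).photonDist (n + 1) * p.photonChain.down (n + 1) := by
  have h : p.pAt true = Real.exp (-p.β * p.ε) * p.pAt false := by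
    simp only [pAt]
    ring
  simp only [photonDist_gibbs, photonChain, h, pow_succ]
  ring

theorem photonDist_gibbs_pos (hβ : 0 < p.β) (n : ℕ) : 0 < (p.gibbs hβ).photonDist n := by
  rw [photonDist_gibbs]
  refine mul_pos (sub_pos.mpr (Real.exp_lt_one_iff.mpr ?_)) (pow_pos (Real.exp_pos _) n)
  nlinarith [mul_pos hβ p.ε_pos]

end MaserParams

end OneAtomMaser

theorem theorem2p3 (p : OneAtomMaser.MaserParams) (hres : p.NonResonant) (hβ : 0 < p.β)
    (ρ : OneAtomMaser.DensityOperator) :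
    Filter.Tendsto
      (fun t : ℕ => OneAtomMaser.tvNorm
        ((p.outcomeLaw ρ).map (OneAtomMaser.shift^[t])) (p.outcomeLaw (p.gibbs hβ)))
      Filter.atTop (nhds 0) := by
  have hstay : p.photonChain.up 0 < 1 := by
    have h : p.photonChain.up 0 ≤ p.pAt true :=
      mul_le_of_le_one_right (p.pAt_nonneg _) (p.α_le_one _)
    linarith [p.pAt_add, p.pAt_pos false]
  have h := p.photonChain.tendsto_evolve (p.photonDist_gibbs_balance hβ)
    (p.photonDist_gibbs_pos hβ) (p.gibbs hβ).hasSum_photonDist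
    (fun n => mul_pos (p.pAt_pos _) (p.α_succ_pos hres n))
    (fun n => mul_pos (p.pAt_pos _) (p.α_succ_pos hres n)) hstay ρ.hasSum_photonDist
  have h2 := ENNReal.tendsto_ofReal (h.const_mul 2)
  rw [mul_zero, ENNReal.ofReal_zero] at h2
  exact tendsto_of_tendsto_of_tendsto_of_le_of_le tendsto_const_nhds h2 (fun _ => zero_le)
    fun t => p.tvNorm_shift_le ρ (p.gibbs hβ) t
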